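/- Let $M^n\subset\mathbb{R}^{n+1}$ be a smooth embedded hypersurface oriented by a smooth unit normal field $N$, with induced metric $g$, shape operator $SX=-\bar\nabla_X N$, Bochner Laplacian $\Delta_B=g^{jk}\nabla_j\nabla_k$ on vector fields, Ricci endomorphism $\mathrm{Ric}$, deformation Laplacian $\Delta_{\mathrm{Def}}=\Delta_B+\mathrm{Ric}$, and Hodge Laplacian $\Delta_H u=-\big((d\delta+\delta d)u^\flat\big)^\sharp$. In Fermi coordinates $(r,x)\mapsto\varphi(x)+rN(\varphi(x))$, where $\varphi$ is a local parametrization of $M$, let $U^i(r,x)$ and $U_i(r,x)$ be the tangential components of an ambient vector field $U$, and let $S^i{}_j(r,x)$ be the shape operator of the parallel surface at signed distance $r$. Let $\alpha\in[0,1]$ and let $u$ be a smooth tangent vector field on $M$. Near every point $p\in M$ there are smooth ambient fields $U$ with $U=u$ on $M$ that satisfy, on the parallel surfaces near $M$, the boundary condition $$\partial_r U^i=2\alpha\,S^i{}_j\,U^j ,$$ and for every such $U$ the tangential part of the ambient Bochner Laplacian $\Delta U$ at $p+rN(p)$ has, on $M$ and in the limit $r\to 0$, one and the same value $\Delta_\alpha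 u(p)$ (the effective thin-shell operator), namely $$\Delta_\alpha u=\Delta_{\mathrm{Def}}u-2\alpha\,\mathrm{Ric}\,u-4\alpha(1-\alpha)\,S^2u .$$ In particular $\Delta_0=\Delta_{\mathrm{Def}}$ and $\Delta_1=\Delta_H$. The extrinsic term $4\alpha(1-\alpha)S^2$ is absent at both endpoints and is present for $0<\alpha<1$: at a point of $M$, $\Delta_\alpha$ and $\Delta_{\mathrm{Def}}-2\alpha\,\mathrm{Ric}$ agree on all smooth tangent fields if and only if $\alpha=0$, or $\alpha=1$, or $S=0$ at that point. Moreover, near $M$ and for a smooth ambient field $U$ tangential to the parallel surface in question (in particular on $M$, if $U$ is tangential to $M$), the boundary condition with $\alpha=0$ is the Navier-slip condition $\langle\bar\nabla_N U,X\rangle+\langle\bar\nabla_X U,N\rangle=0$ for all tangential $X$, and with $\alpha=1$ it is the Hodge (zero tangential vorticity) condition $\langle\bar\nabla_N U,X\rangle-\langle\bar\nabla_X U,N\rangle=0$ for all tangential $X$, equivalently $\partial_r U_i=0$. -/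

import Mathlib

open scoped InnerProductSpace ContDiff Topology Matrix
open Filter Set

noncomputable section

namespace ThinShell

/-- The ambient flat space `ℝ^(n+1)`. -/
abbrev Amb (n : ℕ) := EuclideanSpace ℝ (Fin (n + 1))

/-- The coordinate space of the local parametrizations of an `n`-dimensional hypersurface. -/
abbrev Coord (n : ℕ) := Fin n → ℝ

/-- The partial derivative `∂ᵢ f` at `x`. -/
def pd {n : ℕ} {F : Type*} [NormedAddCommGroup F] [NormedSpace ℝ F]
    (i : Fin n) (f : Coord n → F) (x : Coord n) : F :=
  fderiv ℝ f x (Pi.single i 1)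

/-! ### Intrinsic Riemannian geometry in a chart

`g` is the matrix field of a Riemannian metric in coordinates, `u` a vector field given by its
components `u^i`, `η` a one-form given by `η_i`, `β` a two-tensor given by `β_jk`. -/

section Intrinsic

variable {n : ℕ} (g : Coord n → Matrix (Fin n) (Fin n) ℝ)

/-- Christoffel symbols `Γ^i_jk` of the Levi-Civita connection. -/
def christoffel (i j k : Fin n) (x : Coord n) : ℝ :=
  (1 / 2) * ∑ l, (g x)⁻¹ i l *
    (pd j (fun y => g y l k) x + pd k (fun y => g y l j) x - pd l (fun y => g y j k) x)

/-- `∇_k u^i`. -/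
def covDeriv (u : Coord n → Coord n) (k i : Fin n) (x : Coord n) : ℝ :=
  pd k (fun y => u y i) x + ∑ l, christoffel g i k l x * u x l

/-- The second covariant derivative `∇_j ∇_k u^i`. -/
def covDeriv₂ (u : Coord n → Coord n) (j k i : Fin n) (x : Coord n) : ℝ :=
  pd j (covDeriv g u k i) x + ∑ l, christoffel g i j l x * covDeriv g u k l x
    - ∑ l, christoffel g l j k x * covDeriv g u l i x

/-- The Bochner (rough) Laplacian `(Δ_B u)^i = g^{jk} ∇_j ∇_k u^i`. -/
def bochnerLap (u : Coord n → Coord n) (x : Coord n) : Coord n :=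
  fun i => ∑ j, ∑ k, (g x)⁻¹ j k * covDeriv₂ g u j k i x

/-- The Ricci tensor `Ric_jk` (contraction of the curvature of the Levi-Civita connection;
positive on round spheres). -/
def ricci (x : Coord n) : Matrix (Fin n) (Fin n) ℝ :=
  Matrix.of fun j k => ∑ i, (pd i (christoffel g i j k) x - pd j (christoffel g i i k) x
    + ∑ m, (christoffel g i i m x * christoffel g m j k x
      - christoffel g i j m x * christoffel g m i k x))

/-- The Ricci endomorphism `Ric^i_k = g^{ij} Ric_jk` of the tangent space. -/
def ricciEnd (x : Coord n) : Matrix (Fin n) (Fin n) ℝ := (g x)⁻¹ * ricci g x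

/-- The deformation Laplacian `Δ_Def = Δ_B + Ric`. -/
def defLap (u : Coord n → Coord n) (x : Coord n) : Coord n :=
  bochnerLap g u x + ricciEnd g x *ᵥ u x

/-- The one-form `u_i = g_ij u^j` dual to a vector field. -/
def flat (u : Coord n → Coord n) (x : Coord n) : Coord n := g x *ᵥ u x

/-- The exterior derivative of a one-form: `(dη)_ij = ∂_i η_j - ∂_j η_i`. -/
def extDeriv₁ (η : Coord n → Coord n) (x : Coord n) : Matrix (Fin n) (Fin n) ℝ :=
  Matrix.of fun i j => pd i (fun y => η y j) x - pd j (fun y => η y i) x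

/-- The codifferential of a one-form: `δη = -g^{ij} ∇_i η_j`. -/
def codiff₁ (η : Coord n → Coord n) (x : Coord n) : ℝ :=
  -∑ i, ∑ j, (g x)⁻¹ i j * (pd i (fun y => η y j) x - ∑ l, christoffel g l i j x * η x l)

/-- The codifferential of a two-form: `(δβ)_k = -g^{ij} ∇_i β_jk`. -/
def codiff₂ (β : Coord n → Matrix (Fin n) (Fin n) ℝ) (x : Coord n) : Coord n :=
  fun k => -∑ i, ∑ j, (g x)⁻¹ i j *
    (pd i (fun y => β y j k) x - ∑ l, christoffel g l i j x * β x l k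
      - ∑ l, christoffel g l i k x * β x j l)

/-- The Hodge Laplacian on vector fields, `Δ_H u = -((dδ + δd) u♭)♯`, with the sign for which
it has the same principal part as `Δ_B`. -/
def hodgeLap (u : Coord n → Coord n) (x : Coord n) : Coord n :=
  -((g x)⁻¹ *ᵥ fun k => pd k (codiff₁ g (flat g u)) x
    + codiff₂ g (extDeriv₁ (flat g u)) x k)

end Intrinsic

/-! ### A parametrized piece of a hypersurface

`φ` is a local parametrization and `ν` the unit normal as a function of the coordinates. -/

section Extrinsic

variable {n : ℕ} (φ ν : Coord n → Amb n)

/-- The induced metric `g_ij = ⟨∂_i φ, ∂_j φ⟩`. -/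
def metric (x : Coord n) : Matrix (Fin n) (Fin n) ℝ :=
  Matrix.of fun i j => ⟪pd i φ x, pd j φ x⟫_ℝ

/-- The tangent vector `∑ v^i ∂_i φ` with components `v^i`. -/
def tangentVec (x : Coord n) (v : Coord n) : Amb n := ∑ i, v i • pd i φ x

/-- The components `w^i = g^{ij} ⟨w, ∂_j φ⟩` of (the tangential part of) an ambient vector. -/
def tangComp (x : Coord n) (w : Amb n) : Coord n :=
  (metric φ x)⁻¹ *ᵥ fun j => ⟪w, pd j φ x⟫_ℝ

/-- The matrix `S^i_j` of the shape operator `S X = -∇̄_X N`, i.e. column `j` consists of the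
components of `-∂_j ν`. -/
def shape (x : Coord n) : Matrix (Fin n) (Fin n) ℝ :=
  Matrix.of fun i j => tangComp φ x (-pd j ν x) i

/-- The parametrization `x ↦ φ x + r ν x` of the parallel surface at signed distance `r`, that
is, the Fermi coordinate map `(r, x) ↦ φ x + r ν x` at fixed `r`. -/
def parallel (r : ℝ) (x : Coord n) : Amb n := φ x + r • ν x

/-- The Fermi components `U^i(r, x)` of an ambient vector field. -/
def fermiComp (U : Amb n → Amb n) (r : ℝ) (x : Coord n) : Coord n :=
  tangComp (parallel φ ν r) x (U (parallel φ ν r x))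

/-- The covariant Fermi components `U_i(r, x)` of an ambient vector field. -/
def fermiCocomp (U : Amb n → Amb n) (r : ℝ) (x : Coord n) : Coord n :=
  fun i => ⟪U (parallel φ ν r x), pd i (parallel φ ν r) x⟫_ℝ

/-- The boundary condition `∂_r U^i = 2 α S^i_j U^j` at the point with Fermi coordinates
`(r, x)`; there `S` is the shape operator of the parallel surface at distance `r`. -/
def BoundaryCond (α : ℝ) (U : Amb n → Amb n) (r : ℝ) (x : Coord n) : Prop :=
  ∀ i, deriv (fun s => fermiComp φ ν U s x i) r =
    2 * α * (shape (parallel φ ν r) ν x *ᵥ fermiComp φ ν U r x) i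

end Extrinsic

section Ambient

variable {n : ℕ}

/-- The Navier-slip (stress-free) condition at `q` for a wall with unit normal `N`: twice the
deformation tensor, `⟨∇̄_N U, X⟩ + ⟨∇̄_X U, N⟩`, vanishes for every tangential `X`. -/
def NavierSlip (U : Amb n → Amb n) (q N : Amb n) : Prop :=
  ∀ X : Amb n, ⟪X, N⟫_ℝ = 0 → ⟪fderiv ℝ U q N, X⟫_ℝ + ⟪fderiv ℝ U q X, N⟫_ℝ = 0

/-- The Hodge (zero tangential vorticity) condition at `q` for a wall with unit normal `N`:
`dU♭(N, X) = ⟨∇̄_N U, X⟩ - ⟨∇̄_X U, N⟩` vanishes for every tangential `X`. -/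
def ZeroTangentialVorticity (U : Amb n → Amb n) (q N : Amb n) : Prop :=
  ∀ X : Amb n, ⟪X, N⟫_ℝ = 0 → ⟪fderiv ℝ U q N, X⟫_ℝ - ⟪fderiv ℝ U q X, N⟫_ℝ = 0

/-- The part of `w` orthogonal to the unit vector `N`. -/
def tangentialPart (N w : Amb n) : Amb n := w - ⟪w, N⟫_ℝ • N

/-- `φ` restricted to `V` is a local parametrization of `M`: a smooth immersion that is a
homeomorphism of the open set `V` onto a relatively open subset of `M`. -/
structure IsLocalParam (M : Set (Amb n)) (V : Set (Coord n)) (φ : Coord n → Amb n) : Prop where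
  isOpen : IsOpen V
  smooth : ContDiffOn ℝ ∞ φ V
  immersion : ∀ x ∈ V, LinearIndependent ℝ fun i => pd i φ x
  embedding : Topology.IsEmbedding (V.domRestrict φ)
  image : ∃ W : Set (Amb n), IsOpen W ∧ φ '' V = M ∩ W

/-- Smoothness of a function on `M` (only its values on `M` matter). -/
def IsSmoothOn (M : Set (Amb n)) (f : Amb n → Amb n) : Prop :=
  ∀ V φ, IsLocalParam M V φ → ContDiffOn ℝ ∞ (f ∘ φ) V

/-- `M` is a smooth embedded hypersurface of `ℝ^(n+1)`, oriented by the unit normal `N`. -/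
structure IsOrientedHypersurface (M : Set (Amb n)) (N : Amb n → Amb n) : Prop where
  param : ∀ p ∈ M, ∃ V φ, IsLocalParam M V φ ∧ p ∈ φ '' V
  smooth : IsSmoothOn M N
  unit : ∀ p ∈ M, ‖N p‖ = 1
  normal : ∀ V φ, IsLocalParam M V φ → ∀ x ∈ V, ∀ i, ⟪pd i φ x, N (φ x)⟫_ℝ = 0

/-- `u` is a smooth tangent vector field on `M`. -/
structure IsTangentField (M : Set (Amb n)) (N u : Amb n → Amb n) : Prop where
  smooth : IsSmoothOn M u
  tangent : ∀ p ∈ M, ⟪u p, N p⟫_ℝ = 0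

/-- `U` is a smooth ambient vector field on the open set `Ω` that restricts to `u` on `M ∩ Ω`
and satisfies the boundary condition with parameter `α` on the parallel surfaces near `M`. -/
structure IsShellExtension (M : Set (Amb n)) (N : Amb n → Amb n) (α : ℝ) (u : Amb n → Amb n)
    (Ω : Set (Amb n)) (U : Amb n → Amb n) : Prop where
  isOpen : IsOpen Ω
  smooth : ContDiffOn ℝ ∞ U Ω
  restrict : ∀ q ∈ M ∩ Ω, U q = u q
  boundary : ∀ V φ, IsLocalParam M V φ → ∀ x ∈ V, φ x ∈ Ω →
    ∀ᶠ r in 𝓝 (0 : ℝ), BoundaryCond φ (N ∘ φ) α U r x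

/-- `w` is the value at `p ∈ M` of the effective thin-shell operator with parameter `α` applied
to `u`: extensions of `u` near `p` satisfying the boundary condition exist, and for all of them
the tangential part of the ambient Bochner Laplacian (in flat space, the Laplacian of vector
valued functions) tends to `w` as the distance `r` to `M` tends to `0`. As `𝓝 0` includes the
point `0`, this contains that `w` is its value on `M`. -/
def IsEffectiveValue (M : Set (Amb n)) (N : Amb n → Amb n) (α : ℝ) (u : Amb n → Amb n)
    (p w : Amb n) : Prop :=
  (∃ Ω U, p ∈ Ω ∧ IsShellExtension M N α u Ω U) ∧
    ∀ Ω U, p ∈ Ω → IsShellExtension M N α u Ω U →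
      Tendsto (fun r : ℝ => tangentialPart (N p) (Laplacian.laplacian U (p + r • N p)))
        (𝓝 0) (𝓝 w)

end Ambient

end ThinShell

end

/-! Fix a point of `M` and use its tangent space as a common frame for all parallel surfaces. By
Weingarten's formula the coordinate frame at distance `r` is `(1 - rS)` applied to the frame of `M`,
so the Fermi components are `(1 - rS)⁻¹` times the components in the frame of `M`, and the shape
operator becomes `(1 - rS)⁻¹ S`. In this frame the boundary condition reads: the tangential part of
`∂_N U` equals `(2α - 1) S` applied to the Fermi components (`boundaryCond_iff`). Since it holds for
all small `r`, it can be differentiated once more, which gives `2α(2α - 1) S² u` for the tangential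
part of `∂_N² U` on `M`.

The flat Laplacian splits into `∂_N² U`, minus `tr S · ∂_N U`, plus a surface Laplacian of the
restriction, whose tangential part is `Δ_B u - S² u` by the formulas of Gauss and Weingarten
(`tangComp_laplacian`). The contracted Gauss equation `Ric = (tr S) S - S²` (`ricciEnd_mulVec`)
turns the sum into the stated operator (`tangComp_laplacian_of_boundaryCond`). Only `u`, `S` and `α`
enter, so the value is independent of the extension.

Extensions are found by solving the boundary condition along each normal line: it is implied by `(1
- rB) ∂_r U = (2α - 1) B U`, where `B` is `S` extended by zero on the normal, and this is solved by
`U = (1 - rB)^(1 - 2α) u`. The power is a binomial series in the algebra of ambient endomorphisms,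
which makes `U` smooth (`exists_isShellExtension`).

At `α = 1` the Weitzenböck formula (`hodgeLap_eq`) identifies the result with the Hodge Laplacian.
Between the endpoints the extra term vanishes for all fields only if `S² = 0`, hence `S = 0` by
self-adjointness. The wall conditions are matched by differentiating `⟨U, N⟩ = 0` along the parallel
surface. -/

namespace ThinShell

/-! ### Coordinate partial derivatives -/

section Calculus

variable {n : ℕ} {F : Type*} [NormedAddCommGroup F] [NormedSpace ℝ F]
  {V : Set (Coord n)} {x : Coord n}

lemma differentiableAt_of_contDiffOn {E : Type*} [NormedAddCommGroup E] [NormedSpace ℝ E]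
    {V : Set E} {x : E} {f : E → F} (hV : IsOpen V)
    (hf : ContDiffOn ℝ ∞ f V) (hx : x ∈ V) : DifferentiableAt ℝ f x :=
  (hf.contDiffAt (hV.mem_nhds hx)).differentiableAt (by simp)

lemma contDiffOn_pd {f : Coord n → F} (hV : IsOpen V) (hf : ContDiffOn ℝ ∞ f V) (i : Fin n) :
    ContDiffOn ℝ ∞ (pd i f) V :=
  (hf.fderiv_of_isOpen hV (m := ∞) (by simp)).clm_apply contDiffOn_const

lemma pd_congr_of_eqOn {f h : Coord n → F} (hV : IsOpen V) (hfh : ∀ y ∈ V, f y = h y)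
    (hx : x ∈ V) (i : Fin n) : pd i f x = pd i h x := by
  have : f =ᶠ[𝓝 x] h := Filter.mem_of_superset (hV.mem_nhds hx) hfh
  simp only [pd, this.fderiv_eq]

lemma pd_const (i : Fin n) (c : F) : pd i (fun _ => c) x = 0 := by
  simp [pd]

lemma pd_add {f h : Coord n → F} (hf : DifferentiableAt ℝ f x) (hh : DifferentiableAt ℝ h x)
    (i : Fin n) : pd i (fun y => f y + h y) x = pd i f x + pd i h x := by
  simp [pd, fderiv_fun_add hf hh]

lemma pd_sub {f h : Coord n → F} (hf : DifferentiableAt ℝ f x) (hh : DifferentiableAt ℝ h x)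
    (i : Fin n) : pd i (fun y => f y - h y) x = pd i f x - pd i h x := by
  simp [pd, fderiv_fun_sub hf hh]

lemma pd_neg (f : Coord n → F) (i : Fin n) : pd i (fun y => -f y) x = -pd i f x := by
  simp [pd, fderiv_fun_neg]

lemma pd_const_smul {f : Coord n → F} (hf : DifferentiableAt ℝ f x) (c : ℝ) (i : Fin n) :
    pd i (fun y => c • f y) x = c • pd i f x := by
  simp [pd, fderiv_fun_const_smul hf]

lemma pd_sum {ι : Type*} (s : Finset ι) {f : ι → Coord n → F}
    (hf : ∀ a ∈ s, DifferentiableAt ℝ (f a) x) (i : Fin n) :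
    pd i (fun y => ∑ a ∈ s, f a y) x = ∑ a ∈ s, pd i (f a) x := by
  simp [pd, fderiv_fun_sum hf]

lemma pd_mul {f h : Coord n → ℝ} (hf : DifferentiableAt ℝ f x) (hh : DifferentiableAt ℝ h x)
    (i : Fin n) : pd i (fun y => f y * h y) x = pd i f x * h x + f x * pd i h x := by
  simp [pd, fderiv_fun_mul hf hh]; ring

lemma pd_smul {f : Coord n → ℝ} {h : Coord n → F} (hf : DifferentiableAt ℝ f x)
    (hh : DifferentiableAt ℝ h x) (i : Fin n) :
    pd i (fun y => f y • h y) x = pd i f x • h x + f x • pd i h x := by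
  simp [pd, fderiv_fun_smul hf hh]; abel

lemma pd_inner {f h : Coord n → Amb n} (hf : DifferentiableAt ℝ f x)
    (hh : DifferentiableAt ℝ h x) (i : Fin n) :
    pd i (fun y => ⟪f y, h y⟫_ℝ) x = ⟪pd i f x, h x⟫_ℝ + ⟪f x, pd i h x⟫_ℝ := by
  simp only [pd, fderiv_inner_apply ℝ hf hh]; ring

lemma pd_comp {E : Type*} [NormedAddCommGroup E] [NormedSpace ℝ E] {f : E → F} {h : Coord n → E}
    (hf : DifferentiableAt ℝ f (h x)) (hh : DifferentiableAt ℝ h x) (i : Fin n) :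
    pd i (fun y => f (h y)) x = fderiv ℝ f (h x) (pd i h x) := by
  have := fderiv_comp x hf hh
  simp only [pd]
  rw [show (fun y => f (h y)) = f ∘ h from rfl, this]
  rfl

/-- For component functions this is what the Ricci identity needs; for maps into the ambient space
it expresses flatness, and the Gauss equation comes from it. -/
lemma pd_comm {f : Coord n → F} (hV : IsOpen V) (hf : ContDiffOn ℝ ∞ f V) (hx : x ∈ V)
    (i j : Fin n) : pd i (pd j f) x = pd j (pd i f) x := by
  have hf' := hf.contDiffAt (hV.mem_nhds hx)
  have hd : DifferentiableAt ℝ (fderiv ℝ f) x :=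
    (hf'.fderiv_right (m := 1) (by norm_cast)).differentiableAt (by simp)
  have hsymm : IsSymmSndFDerivAt ℝ f x := hf'.isSymmSndFDerivAt (by simpa using ENat.LEInfty.out)
  have key : ∀ k l : Fin n, pd k (pd l f) x =
      fderiv ℝ (fderiv ℝ f) x (Pi.single k 1) (Pi.single l 1) := by
    intro k l
    have e : pd l f = fun y => fderiv ℝ f y (Pi.single l 1) := rfl
    rw [e, pd, fderiv_clm_apply hd (differentiableAt_const _)]
    simp
  rw [key, key, hsymm.eq]

end Calculus

/-! ### Levi-Civita calculus in a chart and the Weitzenböck formula -/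

section Intrinsic

variable {n : ℕ}

/-- `g` is a smooth Riemannian metric on the open set `V` of coordinates (only symmetry and
nondegeneracy are recorded). -/
structure IsSmoothMetric (V : Set (Coord n)) (g : Coord n → Matrix (Fin n) (Fin n) ℝ) : Prop where
  isOpen : IsOpen V
  smooth : ∀ i j, ContDiffOn ℝ ∞ (fun y => g y i j) V
  symm : ∀ x ∈ V, ∀ i j, g x i j = g x j i
  det : ∀ x ∈ V, IsUnit (g x).det

lemma contDiffOn_det {E : Type*} [NormedAddCommGroup E] [NormedSpace ℝ E] {s : Set E} {m : ℕ}
    {A : E → Matrix (Fin m) (Fin m) ℝ} (hA : ∀ i j, ContDiffOn ℝ ∞ (fun y => A y i j) s) :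
    ContDiffOn ℝ ∞ (fun y => (A y).det) s := by
  simp only [Matrix.det_apply]
  refine ContDiffOn.sum fun σ _ => ?_
  exact (contDiffOn_prod fun i _ => hA _ _).const_smul _

/-- Cramer's rule: the entries are cofactors divided by the determinant. -/
lemma contDiffOn_matrix_inv {E : Type*} [NormedAddCommGroup E] [NormedSpace ℝ E] {s : Set E}
    {m : ℕ} {A : E → Matrix (Fin m) (Fin m) ℝ} (hA : ∀ i j, ContDiffOn ℝ ∞ (fun y => A y i j) s)
    (hdet : ∀ y ∈ s, IsUnit (A y).det) (i j : Fin m) :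
    ContDiffOn ℝ ∞ (fun y => (A y)⁻¹ i j) s := by
  have hadj : ContDiffOn ℝ ∞ (fun y => (A y).adjugate i j) s := by
    simp only [Matrix.adjugate_apply]
    refine contDiffOn_det fun a b => ?_
    simp only [Matrix.updateRow_apply]
    split_ifs
    · exact contDiffOn_const
    · exact hA a b
  have : ∀ y, (A y)⁻¹ i j = ((A y).det)⁻¹ * (A y).adjugate i j := by
    intro y
    simp [Matrix.inv_def]
  simp only [this]
  exact ((contDiffOn_det hA).inv fun y hy => (hdet y hy).ne_zero).mul hadj

/-- Contraction commutes with covariant differentiation: the two Christoffel terms acting on the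
contracted pair of indices cancel. -/
lemma sum_covDeriv₂_trace (g : Coord n → Matrix (Fin n) (Fin n) ℝ)
    (v : Coord n → Coord n) (x : Coord n) (k : Fin n) :
    ∑ i, covDeriv₂ g v k i i x = ∑ i, pd k (covDeriv g v i i) x := by
  simp only [covDeriv₂, Finset.sum_add_distrib, Finset.sum_sub_distrib]
  rw [Finset.sum_comm (f := fun i l => christoffel g i k l x * _), add_sub_cancel_right]

namespace IsSmoothMetric

variable {V : Set (Coord n)} {g : Coord n → Matrix (Fin n) (Fin n) ℝ} {x : Coord n}

lemma contDiffOn_inv (h : IsSmoothMetric V g) (i j : Fin n) :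
    ContDiffOn ℝ ∞ (fun y => (g y)⁻¹ i j) V :=
  contDiffOn_matrix_inv h.smooth h.det i j

lemma contDiffOn_christoffel (h : IsSmoothMetric V g) (i j k : Fin n) :
    ContDiffOn ℝ ∞ (christoffel g i j k) V := by
  unfold christoffel
  refine contDiffOn_const.mul (ContDiffOn.sum fun l _ => (h.contDiffOn_inv i l).mul ?_)
  exact ((contDiffOn_pd h.isOpen (h.smooth _ _) _).add
    (contDiffOn_pd h.isOpen (h.smooth _ _) _)).sub (contDiffOn_pd h.isOpen (h.smooth _ _) _)

lemma contDiffOn_covDeriv (h : IsSmoothMetric V g) {u : Coord n → Coord n}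
    (hu : ∀ i, ContDiffOn ℝ ∞ (fun y => u y i) V) (k i : Fin n) :
    ContDiffOn ℝ ∞ (covDeriv g u k i) V := by
  unfold covDeriv
  exact (contDiffOn_pd h.isOpen (hu i) k).add
    (ContDiffOn.sum fun l _ => (h.contDiffOn_christoffel i k l).mul (hu l))

lemma pd_symm (h : IsSmoothMetric V g) (hx : x ∈ V) (i j k : Fin n) :
    pd i (fun y => g y j k) x = pd i (fun y => g y k j) x :=
  pd_congr_of_eqOn h.isOpen (fun y hy => h.symm y hy j k) hx i

lemma christoffel_symm (h : IsSmoothMetric V g) (hx : x ∈ V) (i j k : Fin n) :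
    christoffel g i j k x = christoffel g i k j x := by
  unfold christoffel
  congr 1
  refine Finset.sum_congr rfl fun l _ => ?_
  rw [h.pd_symm hx l j k]
  ring

/-- The Christoffel symbols of the first kind. -/
lemma sum_mul_christoffel (h : IsSmoothMetric V g) (hx : x ∈ V) (i j k : Fin n) :
    ∑ p, g x i p * christoffel g p j k x = (1 / 2) *
      (pd j (fun y => g y i k) x + pd k (fun y => g y i j) x - pd i (fun y => g y j k) x) := by
  set b : Coord n := fun l =>
    pd j (fun y => g y l k) x + pd k (fun y => g y l j) x - pd l (fun y => g y j k) x with hb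
  have h1 : ∀ p, christoffel g p j k x = (1 / 2) * ((g x)⁻¹ *ᵥ b) p := fun p => rfl
  have h2 : (g x *ᵥ ((g x)⁻¹ *ᵥ b)) i = b i := by
    rw [Matrix.mulVec_mulVec, Matrix.mul_nonsing_inv _ (h.det x hx), Matrix.one_mulVec]
  simp only [h1]
  change _ = 1 / 2 * b i
  rw [← h2]
  simp only [Matrix.mulVec, dotProduct, Finset.mul_sum]
  refine Finset.sum_congr rfl fun p _ => Finset.sum_congr rfl fun q _ => by ring

/-- The Levi-Civita connection is metric. -/
lemma pd_metric (h : IsSmoothMetric V g) (hx : x ∈ V) (i j k : Fin n) :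
    pd i (fun y => g y j k) x = ∑ l, christoffel g l i j x * g x l k +
      ∑ l, christoffel g l i k x * g x j l := by
  have h1 := h.sum_mul_christoffel hx k i j
  have h2 := h.sum_mul_christoffel hx j i k
  have h3 : ∑ l, christoffel g l i j x * g x l k = ∑ p, g x k p * christoffel g p i j x :=
    Finset.sum_congr rfl fun p _ => by rw [h.symm x hx k p]; ring
  have h4 : ∑ l, christoffel g l i k x * g x j l = ∑ p, g x j p * christoffel g p i k x :=
    Finset.sum_congr rfl fun p _ => by ring
  rw [h3, h4, h1, h2, h.pd_symm hx i k j, h.pd_symm hx j k i, h.pd_symm hx k i j]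
  ring

/-- The metric is parallel, so lowering an index commutes with `∇`. Solved for the partial
derivative, this lets `d` and `δ` of a one-form be rewritten through `covDeriv`. -/
lemma pd_flat (h : IsSmoothMetric V g) (hx : x ∈ V) {v : Coord n → Coord n}
    (hv : ∀ i, ContDiffOn ℝ ∞ (fun y => v y i) V) (i j : Fin n) :
    pd i (fun y => flat g v y j) x = ∑ l, christoffel g l i j x * flat g v x l +
      flat g (fun y m => covDeriv g v i m y) x j := by
  have hg := fun a b => differentiableAt_of_contDiffOn h.isOpen (h.smooth a b) hx
  have hv' := fun a => differentiableAt_of_contDiffOn h.isOpen (hv a) hx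
  have e1 : pd i (fun y => flat g v y j) x = ∑ m, (pd i (fun y => g y j m) x * v x m
      + g x j m * pd i (fun y => v y m) x) := by
    simp only [flat, Matrix.mulVec, dotProduct]
    rw [pd_sum _ (fun a _ => (hg j a).fun_mul (hv' a))]
    exact Finset.sum_congr rfl fun m _ => pd_mul (hg j m) (hv' m) i
  rw [e1]
  simp only [h.pd_metric hx, flat, Matrix.mulVec, dotProduct, covDeriv, mul_add, add_mul,
    Finset.sum_add_distrib, Finset.mul_sum, Finset.sum_mul]
  have c1 : ∑ m, ∑ l, christoffel g l i j x * g x l m * v x m =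
      ∑ l, ∑ m, christoffel g l i j x * (g x l m * v x m) := by
    rw [Finset.sum_comm]
    exact Finset.sum_congr rfl fun p _ => Finset.sum_congr rfl fun q _ => by ring
  have c2 : ∑ m, ∑ l, christoffel g l i m x * g x j l * v x m =
      ∑ l, ∑ m, g x j l * (christoffel g l i m x * v x m) := by
    rw [Finset.sum_comm]
    exact Finset.sum_congr rfl fun p _ => Finset.sum_congr rfl fun q _ => by ring
  rw [c1, c2]
  ring

lemma sum_inv_mul_flat (h : IsSmoothMetric V g) (hx : x ∈ V) (w : Fin n → Coord n → Coord n) :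
    ∑ i, ∑ j, (g x)⁻¹ i j * flat g (w i) x j = ∑ i, w i x i := by
  refine Finset.sum_congr rfl fun i _ => ?_
  change ((g x)⁻¹ *ᵥ (g x *ᵥ w i x)) i = _
  rw [Matrix.mulVec_mulVec, Matrix.nonsing_inv_mul _ (h.det x hx), Matrix.one_mulVec]

lemma inv_symm (h : IsSmoothMetric V g) (hx : x ∈ V) (i j : Fin n) :
    (g x)⁻¹ i j = (g x)⁻¹ j i := by
  have : (g x)ᵀ = g x := by ext a b; exact h.symm x hx b a
  have := congrArg (fun A => A i j) (Matrix.transpose_nonsing_inv (g x))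
  simp only [‹(g x)ᵀ = g x›, Matrix.transpose_apply] at this
  exact this.symm

lemma codiff₁_flat (h : IsSmoothMetric V g) (hx : x ∈ V) {v : Coord n → Coord n}
    (hv : ∀ i, ContDiffOn ℝ ∞ (fun y => v y i) V) :
    codiff₁ g (flat g v) x = -∑ i, covDeriv g v i i x := by
  unfold codiff₁
  rw [← h.sum_inv_mul_flat hx (fun i y m => covDeriv g v i m y)]
  simp only [h.pd_flat hx hv, add_sub_cancel_left]

lemma extDeriv₁_flat (h : IsSmoothMetric V g) (hx : x ∈ V) {v : Coord n → Coord n}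
    (hv : ∀ i, ContDiffOn ℝ ∞ (fun y => v y i) V) (i j : Fin n) :
    extDeriv₁ (flat g v) x i j = flat g (fun y m => covDeriv g v i m y) x j
      - flat g (fun y m => covDeriv g v j m y) x i := by
  simp only [extDeriv₁, Matrix.of_apply, h.pd_flat hx hv, h.christoffel_symm hx _ j i]
  ring

lemma contDiffOn_flat (h : IsSmoothMetric V g) {v : Coord n → Coord n}
    (hv : ∀ i, ContDiffOn ℝ ∞ (fun y => v y i) V) (j : Fin n) :
    ContDiffOn ℝ ∞ (fun y => flat g v y j) V := by
  simp only [flat, Matrix.mulVec, dotProduct]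
  exact ContDiffOn.sum fun m _ => (h.smooth j m).mul (hv m)

/-- Since the connection is torsion-free, `du♭` is the antisymmetrized covariant derivative. The
divergence of its first half is the rough Laplacian; that of its second half is a divergence in the
wrong order, to be commuted by the Ricci identity. -/
lemma codiff₂_extDeriv₁_flat (h : IsSmoothMetric V g) (hx : x ∈ V) {v : Coord n → Coord n}
    (hv : ∀ i, ContDiffOn ℝ ∞ (fun y => v y i) V) (k : Fin n) :
    codiff₂ g (extDeriv₁ (flat g v)) x k = -flat g (bochnerLap g v) x k
      + ∑ i, covDeriv₂ g v i k i x := by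
  have hc := fun a b => h.contDiffOn_covDeriv hv a b
  set A : Fin n → Coord n → Coord n := fun j y => flat g (fun z m => covDeriv g v j m z) y with hA
  have hAd : ∀ a b, DifferentiableAt ℝ (fun y => A a y b) x := fun a b =>
    differentiableAt_of_contDiffOn h.isOpen (h.contDiffOn_flat (hc a) b) hx
  have e1 : ∀ i j k, pd i (fun y => extDeriv₁ (flat g v) y j k) x
      = pd i (fun y => A j y k) x - pd i (fun y => A k y j) x := by
    intro i j k
    rw [pd_congr_of_eqOn h.isOpen (fun y hy => h.extDeriv₁_flat hy hv j k) hx]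
    exact pd_sub (hAd j k) (hAd k j) i
  have e2 : ∀ i j k, pd i (fun y => A j y k) x - ∑ l, christoffel g l i j x * A l x k
      - ∑ l, christoffel g l i k x * A j x l = flat g (fun y m => covDeriv₂ g v i j m y) x k := by
    intro i j k
    rw [h.pd_flat hx (hc j) i k]
    simp only [hA, flat, Matrix.mulVec, dotProduct, covDeriv₂, covDeriv, mul_sub,
      Finset.sum_sub_distrib, Finset.mul_sum]
    rw [Finset.sum_comm (f := fun l m => christoffel g l i j x * (g x k m * _))]
    have : ∀ a b c d : ℝ, d = c → a + b - c - a = b - d := by intros; subst_vars; ring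
    refine this _ _ _ _ (Finset.sum_congr rfl fun p _ => Finset.sum_congr rfl fun q _ => by ring)
  have e3 : ∀ i j, pd i (fun y => extDeriv₁ (flat g v) y j k) x
      - ∑ l, christoffel g l i j x * extDeriv₁ (flat g v) x l k
      - ∑ l, christoffel g l i k x * extDeriv₁ (flat g v) x j l
      = flat g (fun y m => covDeriv₂ g v i j m y) x k
        - flat g (fun y m => covDeriv₂ g v i k m y) x j := by
    intro i j
    rw [e1, ← e2, ← e2]
    simp only [h.extDeriv₁_flat hx hv, mul_sub, Finset.sum_sub_distrib, hA]
    ring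
  unfold codiff₂
  simp only [e3, mul_sub, Finset.sum_sub_distrib]
  rw [h.sum_inv_mul_flat hx (fun i y m => covDeriv₂ g v i k m y)]
  have e4 : ∑ i, ∑ j, (g x)⁻¹ i j * flat g (fun y m => covDeriv₂ g v i j m y) x k
      = flat g (bochnerLap g v) x k := by
    simp only [flat, Matrix.mulVec, dotProduct, bochnerLap, Finset.mul_sum]
    rw [Finset.sum_congr rfl fun i _ => Finset.sum_comm, Finset.sum_comm]
    refine Finset.sum_congr rfl fun p _ => Finset.sum_congr rfl fun q _ =>
      Finset.sum_congr rfl fun r _ => by ring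
  rw [e4]
  ring

/-- The contracted Ricci identity. -/
lemma sum_covDeriv₂ (h : IsSmoothMetric V g) (hx : x ∈ V) {v : Coord n → Coord n}
    (hv : ∀ i, ContDiffOn ℝ ∞ (fun y => v y i) V) (k : Fin n) :
    ∑ i, covDeriv₂ g v i k i x = ∑ i, pd k (covDeriv g v i i) x + (ricci g x *ᵥ v x) k := by
  have hv' := fun a => differentiableAt_of_contDiffOn h.isOpen (hv a) hx
  have hpv := fun a b =>
    differentiableAt_of_contDiffOn h.isOpen (contDiffOn_pd h.isOpen (hv a) b) hx
  have hΓ := fun a b c =>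
    differentiableAt_of_contDiffOn h.isOpen (h.contDiffOn_christoffel a b c) hx
  have e1 : ∀ a b m, pd a (covDeriv g v b m) x = pd a (pd b (fun y => v y m)) x
      + ∑ l, (pd a (christoffel g m b l) x * v x l
        + christoffel g m b l x * pd a (fun y => v y l) x) := by
    intro a b m
    have : covDeriv g v b m = fun y => pd b (fun y => v y m) y
      + ∑ l, christoffel g m b l y * v y l := rfl
    rw [this, pd_add (hpv m b) (DifferentiableAt.fun_sum fun l _ => (hΓ m b l).fun_mul (hv' l)),
      pd_sum _ (fun l _ => (hΓ m b l).fun_mul (hv' l))]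
    congr 1
    exact Finset.sum_congr rfl fun l _ => pd_mul (hΓ _ _ _) (hv' l) a
  -- The second partials of the components agree; the derivatives and products of Christoffel
  -- symbols assemble the curvature, and only first-order terms are left over.
  have key : ∀ i, covDeriv₂ g v i k i x = pd k (covDeriv g v i i) x
      + ∑ l, (pd i (christoffel g i k l) x - pd k (christoffel g i i l) x
        + ∑ m, (christoffel g i i m x * christoffel g m k l x
        - christoffel g i k m x * christoffel g m i l x)) * v x l
      + (∑ l, christoffel g i k l x * covDeriv g v i l x
        - ∑ l, christoffel g l i k x * covDeriv g v l i x) := by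
    intro i
    unfold covDeriv₂
    rw [e1, e1, pd_comm h.isOpen (hv i) hx i k]
    simp only [covDeriv, mul_add, add_mul, sub_mul, Finset.sum_add_distrib,
      Finset.sum_sub_distrib, Finset.mul_sum, Finset.sum_mul]
    rw [Finset.sum_comm (f := fun l m => christoffel g i i m x * _ * _),
      Finset.sum_comm (f := fun l m => christoffel g i k m x * christoffel g m i l x * _)]
    simp only [mul_assoc]
    ring
  simp only [key]
  rw [Finset.sum_add_distrib, Finset.sum_add_distrib, Finset.sum_sub_distrib]
  -- After summation the leftover terms differ by a renaming of indices and the symmetry of the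
  -- Christoffel symbols.
  have c1 : ∑ i, ∑ l, christoffel g i k l x * covDeriv g v i l x
      = ∑ i, ∑ l, christoffel g l i k x * covDeriv g v l i x := by
    rw [Finset.sum_comm]
    refine Finset.sum_congr rfl fun p _ => Finset.sum_congr rfl fun q _ => ?_
    rw [h.christoffel_symm hx q k p]
  rw [c1, sub_self, add_zero]
  congr 1
  simp only [ricci, Matrix.mulVec, dotProduct, Matrix.of_apply]
  rw [Finset.sum_comm]
  refine Finset.sum_congr rfl fun p _ => ?_
  rw [Finset.sum_mul]

/-- The Weitzenböck formula. -/
theorem hodgeLap_eq (h : IsSmoothMetric V g) (hx : x ∈ V) {v : Coord n → Coord n}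
    (hv : ∀ i, ContDiffOn ℝ ∞ (fun y => v y i) V) :
    hodgeLap g v x = bochnerLap g v x - ricciEnd g x *ᵥ v x := by
  have hc := fun a b => differentiableAt_of_contDiffOn h.isOpen (h.contDiffOn_covDeriv hv a b) hx
  have e1 : ∀ k, pd k (codiff₁ g (flat g v)) x = -∑ i, pd k (covDeriv g v i i) x := by
    intro k
    rw [pd_congr_of_eqOn h.isOpen (fun y hy => h.codiff₁_flat hy hv) hx, pd_neg,
      pd_sum _ fun i _ => hc i i]
  have e2 : (fun k => pd k (codiff₁ g (flat g v)) x + codiff₂ g (extDeriv₁ (flat g v)) x k)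
      = ricci g x *ᵥ v x - g x *ᵥ bochnerLap g v x := by
    funext k
    rw [e1, h.codiff₂_extDeriv₁_flat hx hv, h.sum_covDeriv₂ hx hv]
    simp only [flat, Pi.sub_apply]
    ring
  unfold hodgeLap
  rw [e2, Matrix.mulVec_sub, Matrix.mulVec_mulVec _ (g x)⁻¹ (g x),
    Matrix.nonsing_inv_mul _ (h.det x hx), Matrix.one_mulVec, Matrix.mulVec_mulVec, ricciEnd]
  abel

end IsSmoothMetric

end Intrinsic

end ThinShell

/-! ### Gauss and Weingarten formulas for a hypersurface in flat space -/

namespace ThinShell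

variable {n : ℕ} {V : Set (Coord n)} {φ ν : Coord n → Amb n} {x : Coord n}

/-- An immersed piece of a hypersurface, parametrized by `φ` on `V`, with unit normal `ν`. -/
structure IsPatch (V : Set (Coord n)) (φ ν : Coord n → Amb n) : Prop where
  isOpen : IsOpen V
  smooth : ContDiffOn ℝ ∞ φ V
  immersion : ∀ x ∈ V, LinearIndependent ℝ fun i => pd i φ x
  smooth_normal : ContDiffOn ℝ ∞ ν V
  unit : ∀ x ∈ V, ‖ν x‖ = 1
  normal : ∀ x ∈ V, ∀ i, ⟪pd i φ x, ν x⟫_ℝ = 0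

/-- The second fundamental form `b_jk = ⟨∂_j ∂_k φ, ν⟩`. -/
noncomputable def secondForm (φ ν : Coord n → Amb n) (x : Coord n) : Matrix (Fin n) (Fin n) ℝ :=
  Matrix.of fun j k => ⟪pd j (pd k φ) x, ν x⟫_ℝ

lemma tangComp_add (w w' : Amb n) : tangComp φ x (w + w') = tangComp φ x w + tangComp φ x w' := by
  simp only [tangComp, inner_add_left, ← Matrix.mulVec_add]
  rfl

lemma tangComp_smul (c : ℝ) (w : Amb n) : tangComp φ x (c • w) = c • tangComp φ x w := by
  simp only [tangComp, real_inner_smul_left, ← Matrix.mulVec_smul]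
  rfl

/-- `tangComp` as a continuous linear map. -/
noncomputable def tangCompL (φ : Coord n → Amb n) (x : Coord n) : Amb n →L[ℝ] Coord n :=
  LinearMap.toContinuousLinearMap
    { toFun := tangComp φ x, map_add' := tangComp_add, map_smul' := tangComp_smul }

@[simp] lemma tangCompL_apply (w : Amb n) : tangCompL φ x w = tangComp φ x w := rfl

/-- `tangentVec` as a continuous linear map. -/
noncomputable def tangentVecL (φ : Coord n → Amb n) (x : Coord n) : Coord n →L[ℝ] Amb n :=
  ∑ i, (ContinuousLinearMap.proj (R := ℝ) (φ := fun _ : Fin n => ℝ) i).smulRight (pd i φ x)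

@[simp] lemma tangentVecL_apply (v : Coord n) : tangentVecL φ x v = tangentVec φ x v := by
  simp [tangentVecL, tangentVec]

lemma inner_tangentVec (v : Coord n) (j : Fin n) :
    ⟪tangentVec φ x v, pd j φ x⟫_ℝ = (metric φ x *ᵥ v) j := by
  simp only [tangentVec, sum_inner, real_inner_smul_left, Matrix.mulVec, dotProduct, metric,
    Matrix.of_apply]
  exact Finset.sum_congr rfl fun i _ => by rw [real_inner_comm]; ring

lemma tangentVec_single (i : Fin n) : tangentVec φ x (Pi.single i 1) = pd i φ x := by
  simp [tangentVec, Pi.single_apply]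

namespace IsPatch

lemma isUnit_det_metric (h : IsPatch V φ ν) (hx : x ∈ V) : IsUnit (metric φ x).det :=
  (Matrix.det_gram_ne_zero_iff_linearIndependent (𝕜 := ℝ)).2 (h.immersion x hx) |>.isUnit

lemma contDiffOn_frame (h : IsPatch V φ ν) (i : Fin n) : ContDiffOn ℝ ∞ (pd i φ) V :=
  contDiffOn_pd h.isOpen h.smooth i

lemma differentiableAt_frame (h : IsPatch V φ ν) (hx : x ∈ V) (i : Fin n) :
    DifferentiableAt ℝ (pd i φ) x :=
  differentiableAt_of_contDiffOn h.isOpen (h.contDiffOn_frame i) hx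

lemma differentiableAt_param (h : IsPatch V φ ν) (hx : x ∈ V) : DifferentiableAt ℝ φ x :=
  differentiableAt_of_contDiffOn h.isOpen h.smooth hx

lemma differentiableAt_normal (h : IsPatch V φ ν) (hx : x ∈ V) : DifferentiableAt ℝ ν x :=
  differentiableAt_of_contDiffOn h.isOpen h.smooth_normal hx

lemma isSmoothMetric (h : IsPatch V φ ν) : IsSmoothMetric V (metric φ) where
  isOpen := h.isOpen
  smooth i j := (h.contDiffOn_frame i).inner ℝ (h.contDiffOn_frame j)
  symm := fun _ _ i j => real_inner_comm (pd j φ _) (pd i φ _)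
  det _ hx := h.isUnit_det_metric hx

lemma tangComp_tangentVec (h : IsPatch V φ ν) (hx : x ∈ V) (v : Coord n) :
    tangComp φ x (tangentVec φ x v) = v := by
  have : (fun j => ⟪tangentVec φ x v, pd j φ x⟫_ℝ) = metric φ x *ᵥ v :=
    funext fun j => inner_tangentVec v j
  rw [tangComp, this, Matrix.mulVec_mulVec, Matrix.nonsing_inv_mul _ (h.isUnit_det_metric hx),
    Matrix.one_mulVec]

lemma tangComp_normal (h : IsPatch V φ ν) (hx : x ∈ V) : tangComp φ x (ν x) = 0 := by
  have : (fun j => ⟪ν x, pd j φ x⟫_ℝ) = 0 :=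
    funext fun j => by rw [real_inner_comm]; exact h.normal x hx j
  rw [tangComp, this, Matrix.mulVec_zero]

lemma inner_tangentVec_normal (h : IsPatch V φ ν) (hx : x ∈ V) (v : Coord n) :
    ⟪tangentVec φ x v, ν x⟫_ℝ = 0 := by
  simp [tangentVec, sum_inner, real_inner_smul_left, h.normal x hx]

lemma inner_normal_normal (h : IsPatch V φ ν) (hx : x ∈ V) : ⟪ν x, ν x⟫_ℝ = 1 := by
  rw [real_inner_self_eq_norm_sq, h.unit x hx]; norm_num

lemma metric_mulVec_tangComp (h : IsPatch V φ ν) (hx : x ∈ V) (w : Amb n) (j : Fin n) :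
    (metric φ x *ᵥ tangComp φ x w) j = ⟪w, pd j φ x⟫_ℝ := by
  rw [tangComp, Matrix.mulVec_mulVec, Matrix.mul_nonsing_inv _ (h.isUnit_det_metric hx),
    Matrix.one_mulVec]

/-- The tangent frame and the unit normal. -/
lemma linearIndependent_frame_normal (h : IsPatch V φ ν) (hx : x ∈ V) :
    LinearIndependent ℝ (fun o : Option (Fin n) => o.elim (ν x) fun i => pd i φ x) := by
  rw [linearIndependent_option]
  refine ⟨h.immersion x hx, fun hmem => ?_⟩
  have : ∀ z ∈ Submodule.span ℝ (Set.range fun i => pd i φ x), ⟪z, ν x⟫_ℝ = 0 := by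
    intro z hz
    induction hz using Submodule.span_induction with
    | mem z hz => obtain ⟨i, rfl⟩ := hz; exact h.normal x hx i
    | zero => simp
    | add a b _ _ ha hb => rw [inner_add_left, ha, hb, add_zero]
    | smul c a _ ha => rw [real_inner_smul_left, ha, mul_zero]
  have h1 := this (ν x) hmem
  rw [h.inner_normal_normal hx] at h1
  exact one_ne_zero h1

/-- The frame and the normal are `n + 1` independent vectors in dimension `n + 1`, hence span. -/
lemma eq_zero_of_inner (h : IsPatch V φ ν) (hx : x ∈ V) {z : Amb n}
    (h1 : ∀ i, ⟪z, pd i φ x⟫_ℝ = 0) (h2 : ⟪z, ν x⟫_ℝ = 0) : z = 0 := by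
  have hspan := (h.linearIndependent_frame_normal hx).span_eq_top_of_card_eq_finrank' (by simp)
  have : ∀ w ∈ Submodule.span ℝ (Set.range
      (fun o : Option (Fin n) => o.elim (ν x) fun i => pd i φ x)), ⟪z, w⟫_ℝ = 0 := by
    intro w hw
    induction hw using Submodule.span_induction with
    | mem w hw => obtain ⟨o, rfl⟩ := hw; cases o with
      | none => exact h2
      | some i => exact h1 i
    | zero => simp
    | add a b _ _ ha hb => rw [inner_add_right, ha, hb, add_zero]
    | smul c a _ ha => rw [real_inner_smul_right, ha, mul_zero]
  exact inner_self_eq_zero.1 (this z (hspan ▸ Submodule.mem_top))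

/-- Splitting into the tangential and normal parts. -/
lemma eq_tangentVec_add (h : IsPatch V φ ν) (hx : x ∈ V) (w : Amb n) :
    w = tangentVec φ x (tangComp φ x w) + ⟪w, ν x⟫_ℝ • ν x := by
  rw [← sub_eq_zero]
  refine h.eq_zero_of_inner hx (fun i => ?_) ?_
  · rw [inner_sub_left, inner_add_left, real_inner_smul_left, inner_tangentVec,
      h.metric_mulVec_tangComp hx, real_inner_comm (pd i φ x) (ν x), h.normal x hx]
    ring
  · rw [inner_sub_left, inner_add_left, real_inner_smul_left, h.inner_tangentVec_normal hx,
      h.inner_normal_normal hx]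
    ring

lemma tangentVec_tangComp (h : IsPatch V φ ν) (hx : x ∈ V) (w : Amb n) :
    tangentVec φ x (tangComp φ x w) = tangentialPart (ν x) w := by
  rw [tangentialPart]
  exact eq_sub_of_add_eq (h.eq_tangentVec_add hx w).symm

lemma tangentVec_tangComp_of_tangent (h : IsPatch V φ ν) (hx : x ∈ V) {w : Amb n}
    (hw : ⟪w, ν x⟫_ℝ = 0) : tangentVec φ x (tangComp φ x w) = w := by
  rw [h.tangentVec_tangComp hx, tangentialPart, hw, zero_smul, sub_zero]

lemma inner_normal_pd_normal (h : IsPatch V φ ν) (hx : x ∈ V) (j : Fin n) :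
    ⟪pd j ν x, ν x⟫_ℝ = 0 := by
  have h1 : pd j (fun y => ⟪ν y, ν y⟫_ℝ) x = 0 := by
    rw [pd_congr_of_eqOn h.isOpen (fun y hy => h.inner_normal_normal hy) hx, pd_const]
  rw [pd_inner (h.differentiableAt_normal hx) (h.differentiableAt_normal hx),
    real_inner_comm (pd j ν x) (ν x)] at h1
  linarith

/-- Weingarten's formula. -/
lemma pd_normal (h : IsPatch V φ ν) (hx : x ∈ V) (j : Fin n) :
    pd j ν x = -tangentVec φ x (shape φ ν x *ᵥ Pi.single j 1) := by
  have : shape φ ν x *ᵥ Pi.single j 1 = tangComp φ x (-pd j ν x) := by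
    ext i; simp [shape]
  rw [this, h.tangentVec_tangComp_of_tangent hx, neg_neg]
  rw [inner_neg_left, h.inner_normal_pd_normal hx, neg_zero]

lemma secondForm_symm (h : IsPatch V φ ν) (hx : x ∈ V) (j k : Fin n) :
    secondForm φ ν x j k = secondForm φ ν x k j := by
  simp only [secondForm, Matrix.of_apply, pd_comm h.isOpen h.smooth hx j k]

/-- Differentiate `⟨∂_k φ, ν⟩ = 0`. -/
lemma secondForm_eq_inner (h : IsPatch V φ ν) (hx : x ∈ V) (j k : Fin n) :
    secondForm φ ν x j k = -⟪pd j ν x, pd k φ x⟫_ℝ := by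
  have h1 : pd j (fun y => ⟪pd k φ y, ν y⟫_ℝ) x = 0 := by
    rw [pd_congr_of_eqOn h.isOpen (fun y hy => h.normal y hy k) hx, pd_const]
  rw [pd_inner (h.differentiableAt_frame hx k) (h.differentiableAt_normal hx),
    real_inner_comm (pd j ν x) (pd k φ x)] at h1
  simp only [secondForm, Matrix.of_apply]
  linarith

lemma secondForm_eq (h : IsPatch V φ ν) (hx : x ∈ V) :
    secondForm φ ν x = metric φ x * shape φ ν x := by
  ext k j
  rw [h.secondForm_symm hx, h.secondForm_eq_inner hx, h.pd_normal hx, inner_neg_left, neg_neg,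
    inner_tangentVec, Matrix.mulVec_mulVec]
  simp

lemma metric_transpose : (metric φ x)ᵀ = metric φ x := by
  ext i j; exact real_inner_comm (pd i φ x) (pd j φ x)

/-- The shape operator is self-adjoint. -/
lemma shape_transpose_mul_metric (h : IsPatch V φ ν) (hx : x ∈ V) :
    (shape φ ν x)ᵀ * metric φ x = metric φ x * shape φ ν x := by
  rw [← h.secondForm_eq hx]
  have : (secondForm φ ν x)ᵀ = secondForm φ ν x := by
    ext j k; exact h.secondForm_symm hx k j
  rw [← this, h.secondForm_eq hx, Matrix.transpose_mul, metric_transpose]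

/-- Gauss' formula for the coordinate frame. -/
lemma pd_frame (h : IsPatch V φ ν) (hx : x ∈ V) (j k : Fin n) :
    pd j (pd k φ) x = tangentVec φ x (fun i => christoffel (metric φ) i j k x)
      + secondForm φ ν x j k • ν x := by
  have hd := h.differentiableAt_frame hx
  have hm : ∀ a b c, pd a (fun y => metric φ y b c) x
      = ⟪pd a (pd b φ) x, pd c φ x⟫_ℝ + ⟪pd b φ x, pd a (pd c φ) x⟫_ℝ := fun a b c =>
    pd_inner (hd b) (hd c) a
  have key : tangComp φ x (pd j (pd k φ) x) = fun i => christoffel (metric φ) i j k x := by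
    have hG := h.isSmoothMetric
    have e : metric φ x *ᵥ tangComp φ x (pd j (pd k φ) x)
        = metric φ x *ᵥ fun i => christoffel (metric φ) i j k x := by
      funext l
      rw [h.metric_mulVec_tangComp hx]
      change _ = ∑ p, metric φ x l p * christoffel (metric φ) p j k x
      -- Koszul's formula: with the derivatives of the metric expanded and second derivatives of `φ`
      -- symmetric, four of the six inner products cancel.
      rw [hG.sum_mul_christoffel hx, hm, hm, hm, pd_comm h.isOpen h.smooth hx k j,
        pd_comm h.isOpen h.smooth hx j l, pd_comm h.isOpen h.smooth hx k l,
        real_inner_comm (pd l φ x) (pd j (pd k φ) x),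
        real_inner_comm (pd l (pd k φ) x) (pd j φ x)]
      ring
    have := congrArg (fun v => (metric φ x)⁻¹ *ᵥ v) e
    simpa only [Matrix.mulVec_mulVec, Matrix.nonsing_inv_mul _ (h.isUnit_det_metric hx),
      Matrix.one_mulVec] using this
  conv_lhs => rw [h.eq_tangentVec_add hx (pd j (pd k φ) x), key]
  rfl

/-- Gauss' formula: the derivative of a tangent field. -/
lemma pd_tangentVec (h : IsPatch V φ ν) (hx : x ∈ V) {v : Coord n → Coord n}
    (hv : ∀ i, ContDiffOn ℝ ∞ (fun y => v y i) V) (k : Fin n) :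
    pd k (fun y => tangentVec φ y (v y)) x
      = tangentVec φ x (fun i => covDeriv (metric φ) v k i x)
        + (secondForm φ ν x *ᵥ v x) k • ν x := by
  have hv' := fun a => differentiableAt_of_contDiffOn h.isOpen (hv a) hx
  have hd := h.differentiableAt_frame hx
  unfold tangentVec
  rw [pd_sum _ fun i _ => (hv' i).fun_smul (hd i)]
  rw [Finset.sum_congr rfl fun i _ => pd_smul (hv' i) (hd i) k]
  simp only [h.pd_frame hx, covDeriv, add_smul, Finset.sum_add_distrib, smul_add, Matrix.mulVec,
    dotProduct, Finset.sum_smul, tangentVec, Finset.smul_sum, smul_smul]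
  rw [Finset.sum_comm (f := fun i j => (v x i * _) • pd j φ x), add_assoc]
  simp only [mul_comm (v x _)]

lemma contDiffOn_tangComp (h : IsPatch V φ ν) {w : Coord n → Amb n} (hw : ContDiffOn ℝ ∞ w V)
    (i : Fin n) : ContDiffOn ℝ ∞ (fun y => tangComp φ y (w y) i) V := by
  simp only [tangComp, Matrix.mulVec, dotProduct]
  exact ContDiffOn.sum fun j _ =>
    (h.isSmoothMetric.contDiffOn_inv i j).mul (hw.inner ℝ (h.contDiffOn_frame j))

lemma contDiffOn_mulVec {A : Coord n → Matrix (Fin n) (Fin n) ℝ} {v : Coord n → Coord n}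
    (hA : ∀ i j, ContDiffOn ℝ ∞ (fun y => A y i j) V)
    (hv : ∀ i, ContDiffOn ℝ ∞ (fun y => v y i) V) (i : Fin n) :
    ContDiffOn ℝ ∞ (fun y => (A y *ᵥ v y) i) V := by
  simp only [Matrix.mulVec, dotProduct]
  exact ContDiffOn.sum fun j _ => (hA i j).mul (hv j)

lemma contDiffOn_secondForm (h : IsPatch V φ ν) (i j : Fin n) :
    ContDiffOn ℝ ∞ (fun y => secondForm φ ν y i j) V :=
  (contDiffOn_pd h.isOpen (h.contDiffOn_frame j) i).inner ℝ h.smooth_normal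

/-- The tangential part of the second derivatives of a tangent field. -/
lemma tangComp_pd_pd_tangentVec (h : IsPatch V φ ν) (hx : x ∈ V) {v : Coord n → Coord n}
    (hv : ∀ i, ContDiffOn ℝ ∞ (fun y => v y i) V) (j k i : Fin n) :
    tangComp φ x (pd j (pd k fun y => tangentVec φ y (v y)) x) i
      = pd j (covDeriv (metric φ) v k i) x
        + ∑ l, christoffel (metric φ) i j l x * covDeriv (metric φ) v k l x
        - shape φ ν x i j * (secondForm φ ν x *ᵥ v x) k := by
  have hc : ∀ i, ContDiffOn ℝ ∞ (fun y => covDeriv (metric φ) v k i y) V :=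
    h.isSmoothMetric.contDiffOn_covDeriv hv k
  have hβ : ContDiffOn ℝ ∞ (fun y => (secondForm φ ν y *ᵥ v y) k) V :=
    contDiffOn_mulVec h.contDiffOn_secondForm hv k
  have hT : ContDiffOn ℝ ∞ (fun y => tangentVec φ y fun i => covDeriv (metric φ) v k i y) V := by
    unfold tangentVec
    exact ContDiffOn.sum fun i _ => (hc i).smul (h.contDiffOn_frame i)
  have dβ := differentiableAt_of_contDiffOn h.isOpen hβ hx
  have dν := h.differentiableAt_normal hx
  rw [pd_congr_of_eqOn h.isOpen (fun y hy => h.pd_tangentVec hy hv k) hx,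
    pd_add (differentiableAt_of_contDiffOn h.isOpen hT hx) (dβ.fun_smul dν),
    h.pd_tangentVec hx hc j, pd_smul dβ dν, h.pd_normal hx]
  simp only [← tangCompL_apply, map_add, map_smul, map_neg]
  simp only [tangCompL_apply, h.tangComp_tangentVec hx, h.tangComp_normal hx]
  simp only [smul_zero, add_zero, zero_add, Pi.add_apply, Pi.smul_apply, Pi.neg_apply,
    Matrix.mulVec_single_one, Matrix.col_apply, smul_eq_mul]
  change pd j (covDeriv (metric φ) v k i) x + _ + _ = _
  ring

/-- The contracted Gauss equation. -/
lemma ricciEnd_mulVec (h : IsPatch V φ ν) (hx : x ∈ V) (w : Coord n) :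
    ricciEnd (metric φ) x *ᵥ w = (shape φ ν x).trace • (shape φ ν x *ᵥ w)
      - (shape φ ν x) ^ 2 *ᵥ w := by
  have hG := h.isSmoothMetric
  -- The Ricci tensor is probed with the field of constant components `w`.
  have hv : ∀ i, ContDiffOn ℝ ∞ (fun y => (fun _ : Coord n => w) y i) V :=
    fun i => contDiffOn_const
  have hW : ContDiffOn ℝ ∞ (fun y => tangentVec φ y w) V := by
    unfold tangentVec
    exact ContDiffOn.sum fun i _ => ContDiffOn.smul (f := fun _ => w i) contDiffOn_const (h.contDiffOn_frame i)
  set S := shape φ ν x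
  set β := secondForm φ ν x *ᵥ w with hβ
  -- The ambient second partials of this field commute, so the commutator of intrinsic covariant
  -- derivatives is balanced by the extrinsic terms: the Gauss equation.
  have e1 : ∀ i k, covDeriv₂ (metric φ) (fun _ => w) i k i x
      - covDeriv₂ (metric φ) (fun _ => w) k i i x = S i i * β k - S i k * β i := by
    intro i k
    have h1 := h.tangComp_pd_pd_tangentVec hx hv i k i
    have h2 := h.tangComp_pd_pd_tangentVec hx hv k i i
    rw [pd_comm h.isOpen hW hx i k, h2] at h1
    have h3 : ∑ l, christoffel (metric φ) l i k x * covDeriv (metric φ) (fun _ => w) l i x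
        = ∑ l, christoffel (metric φ) l k i x * covDeriv (metric φ) (fun _ => w) l i x :=
      Finset.sum_congr rfl fun l _ => by rw [hG.christoffel_symm hx l i k]
    unfold covDeriv₂
    rw [h3]
    linarith
  have e2 : ricci (metric φ) x *ᵥ w = S.trace • β - Sᵀ *ᵥ β := by
    funext k
    have h1 := hG.sum_covDeriv₂ hx hv k
    rw [← sum_covDeriv₂_trace, ← sub_eq_iff_eq_add', ← Finset.sum_sub_distrib] at h1
    rw [← h1]
    simp only [e1, Finset.sum_sub_distrib, ← Finset.sum_mul]
    simp [Matrix.trace, Matrix.mulVec, dotProduct]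
  have e3 : β = metric φ x *ᵥ (S *ᵥ w) := by
    rw [hβ, h.secondForm_eq hx, Matrix.mulVec_mulVec]
  rw [ricciEnd, ← Matrix.mulVec_mulVec, e2, Matrix.mulVec_sub, Matrix.mulVec_smul, e3,
    Matrix.mulVec_mulVec _ Sᵀ, h.shape_transpose_mul_metric hx, ← Matrix.mulVec_mulVec _ (metric φ x) S]
  simp only [Matrix.mulVec_mulVec _ (metric φ x)⁻¹, Matrix.nonsing_inv_mul _ (h.isUnit_det_metric hx),
    Matrix.one_mulVec, pow_two]
  rw [Matrix.mulVec_mulVec]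

/-- The tangential part of the componentwise Laplacian on the hypersurface of a tangent field. -/
lemma tangComp_surfaceLap (h : IsPatch V φ ν) (hx : x ∈ V) {v : Coord n → Coord n}
    (hv : ∀ i, ContDiffOn ℝ ∞ (fun y => v y i) V) :
    tangComp φ x (∑ j, ∑ k, (metric φ x)⁻¹ j k •
      (pd j (pd k fun y => tangentVec φ y (v y)) x
        - ∑ l, christoffel (metric φ) l j k x • pd l (fun y => tangentVec φ y (v y)) x))
      = bochnerLap (metric φ) v x - (shape φ ν x) ^ 2 *ᵥ v x := by
  set S := shape φ ν x
  have e1 : ∀ j k, tangComp φ x (pd j (pd k fun y => tangentVec φ y (v y)) x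
        - ∑ l, christoffel (metric φ) l j k x • pd l (fun y => tangentVec φ y (v y)) x)
      = fun i => covDeriv₂ (metric φ) v j k i x - S i j * (secondForm φ ν x *ᵥ v x) k := by
    intro j k
    funext i
    simp only [← tangCompL_apply, map_sub, map_sum, map_smul, h.pd_tangentVec hx hv, map_add]
    simp only [tangCompL_apply, h.tangComp_tangentVec hx, h.tangComp_normal hx, Pi.sub_apply,
      Finset.sum_apply, h.tangComp_pd_pd_tangentVec hx hv]
    simp only [smul_zero, add_zero, Pi.smul_apply, smul_eq_mul, covDeriv₂]
    ring
  -- One factor `S` comes from differentiating the normal; the other is the second fundamental form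
  -- with an index raised.
  have e2 : ∀ i, ∑ j, ∑ k, (metric φ x)⁻¹ j k * (S i j * (secondForm φ ν x *ᵥ v x) k)
      = (S ^ 2 *ᵥ v x) i := by
    intro i
    have : S ^ 2 *ᵥ v x = S *ᵥ ((metric φ x)⁻¹ *ᵥ (secondForm φ ν x *ᵥ v x)) := by
      rw [h.secondForm_eq hx, Matrix.mulVec_mulVec _ (metric φ x)⁻¹, ← mul_assoc,
        Matrix.nonsing_inv_mul _ (h.isUnit_det_metric hx), one_mul, Matrix.mulVec_mulVec, pow_two]
    rw [this]
    conv_rhs => rw [Matrix.mulVec, dotProduct]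
    refine Finset.sum_congr rfl fun j _ => ?_
    conv_rhs => rw [Matrix.mulVec, dotProduct, Finset.mul_sum]
    exact Finset.sum_congr rfl fun k _ => by ring
  funext i
  simp only [← tangCompL_apply, map_sum, map_smul]
  simp only [tangCompL_apply, e1, Finset.sum_apply, Pi.smul_apply, smul_eq_mul, mul_sub,
    Finset.sum_sub_distrib, e2, Pi.sub_apply, bochnerLap]

end IsPatch

end ThinShell

/-! ### Parallel surfaces, the boundary condition and the ambient Laplacian -/

namespace ThinShell

variable {n : ℕ} {V : Set (Coord n)} {φ ν : Coord n → Amb n} {x : Coord n}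

namespace IsPatch

lemma mono (h : IsPatch V φ ν) {V' : Set (Coord n)} (hV' : IsOpen V') (hsub : V' ⊆ V) :
    IsPatch V' φ ν where
  isOpen := hV'
  smooth := h.smooth.mono hsub
  immersion x hx := h.immersion x (hsub hx)
  smooth_normal := h.smooth_normal.mono hsub
  unit x hx := h.unit x (hsub hx)
  normal x hx := h.normal x (hsub hx)

lemma inner_eq_dotProduct (h : IsPatch V φ ν) (hx : x ∈ V) (w : Amb n) (c : Coord n) :
    ⟪w, tangentVec φ x c⟫_ℝ = c ⬝ᵥ (metric φ x *ᵥ tangComp φ x w) := by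
  simp only [tangentVec, inner_sum, real_inner_smul_right, dotProduct, h.metric_mulVec_tangComp hx]

/-- Change of frame in the tangent space. -/
lemma tangComp_change (h : IsPatch V φ ν) (hx : x ∈ V) {ψ : Coord n → Amb n}
    {A : Matrix (Fin n) (Fin n) ℝ} (hA : IsUnit A.det)
    (hψ : ∀ i, pd i ψ x = tangentVec φ x (A *ᵥ Pi.single i 1)) (w : Amb n) :
    tangComp ψ x w = A⁻¹ *ᵥ tangComp φ x w := by
  have hcol : ∀ (w : Amb n) i, ⟪w, pd i ψ x⟫_ℝ = (Aᵀ *ᵥ (metric φ x *ᵥ tangComp φ x w)) i := by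
    intro w i
    rw [hψ, h.inner_eq_dotProduct hx, Matrix.mulVec_single_one]
    rfl
  have hmet : metric ψ x = Aᵀ * metric φ x * A := by
    ext i j
    rw [show metric ψ x i j = ⟪pd i ψ x, pd j ψ x⟫_ℝ from rfl, real_inner_comm, hcol, hψ j,
      h.tangComp_tangentVec hx, Matrix.mulVec_mulVec, Matrix.mulVec_mulVec,
      Matrix.mulVec_single_one, Matrix.col_apply]
  have hdet : IsUnit (metric ψ x).det := by
    rw [hmet, Matrix.det_mul, Matrix.det_mul, Matrix.det_transpose]
    exact (hA.mul (h.isUnit_det_metric hx)).mul hA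
  have e : (fun j => ⟪w, pd j ψ x⟫_ℝ) = metric ψ x *ᵥ (A⁻¹ *ᵥ tangComp φ x w) := by
    funext j
    rw [hcol, hmet, Matrix.mulVec_mulVec _ _ A⁻¹, mul_assoc _ A, Matrix.mul_nonsing_inv _ hA,
      mul_one, Matrix.mulVec_mulVec]
  rw [tangComp, e, Matrix.mulVec_mulVec, Matrix.nonsing_inv_mul _ hdet, Matrix.one_mulVec]

/-- Weingarten's formula. It expresses everything on the parallel surface in a frame independent of
`r`, where `r`-derivatives can be taken. -/
lemma pd_parallel (h : IsPatch V φ ν) (hx : x ∈ V) (r : ℝ) (i : Fin n) :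
    pd i (parallel φ ν r) x = tangentVec φ x ((1 - r • shape φ ν x) *ᵥ Pi.single i 1) := by
  have : pd i (parallel φ ν r) x = pd i φ x + r • pd i ν x := by
    unfold parallel
    rw [pd_add (h.differentiableAt_param hx) ((h.differentiableAt_normal hx).fun_const_smul r),
      pd_const_smul (h.differentiableAt_normal hx)]
  rw [this, h.pd_normal hx, Matrix.sub_mulVec, Matrix.one_mulVec, Matrix.smul_mulVec]
  simp only [← tangentVecL_apply, map_sub, map_smul]
  simp only [tangentVecL_apply, tangentVec_single]
  rw [smul_neg, sub_eq_add_neg]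

lemma tangComp_parallel (h : IsPatch V φ ν) (hx : x ∈ V) {r : ℝ}
    (hr : IsUnit (1 - r • shape φ ν x).det) (w : Amb n) :
    tangComp (parallel φ ν r) x w = (1 - r • shape φ ν x)⁻¹ *ᵥ tangComp φ x w :=
  h.tangComp_change hx hr (fun i => h.pd_parallel hx r i) w

/-- The normal does not change along its line, so `∂_j ν` is the same vector and only the frame
resolving it is new. -/
lemma shape_parallel (h : IsPatch V φ ν) (hx : x ∈ V) {r : ℝ}
    (hr : IsUnit (1 - r • shape φ ν x).det) :
    shape (parallel φ ν r) ν x = (1 - r • shape φ ν x)⁻¹ * shape φ ν x := by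
  ext i j
  simp only [shape, Matrix.of_apply, h.tangComp_parallel hx hr]
  rfl

lemma isOpen_isUnit_det (S : Matrix (Fin n) (Fin n) ℝ) :
    IsOpen {r : ℝ | IsUnit (1 - r • S).det} := by
  simp only [isUnit_iff_ne_zero]
  refine isOpen_ne_fun (Continuous.matrix_det ?_) continuous_const
  fun_prop

lemma hasDerivAt_tangComp {U : Amb n → Amb n} {r : ℝ}
    (hU : DifferentiableAt ℝ U (parallel φ ν r x)) :
    HasDerivAt (fun s => tangComp φ x (U (parallel φ ν s x)))
      (tangComp φ x (fderiv ℝ U (parallel φ ν r x) (ν x))) r := by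
  have h1 : HasDerivAt (fun s : ℝ => parallel φ ν s x) (ν x) r := by
    simpa [parallel] using ((hasDerivAt_id r).smul_const (ν x)).const_add (φ x)
  exact (tangCompL φ x).hasFDerivAt.comp_hasDerivAt r (hU.hasFDerivAt.comp_hasDerivAt r h1)

/-- Needed because `deriv` is `0` by default where no derivative exists: this lets the componentwise
condition be read as one on the derivative of a vector. -/
lemma differentiableAt_fermiComp (h : IsPatch V φ ν) (hx : x ∈ V) {U : Amb n → Amb n} {r : ℝ}
    (hr : IsUnit (1 - r • shape φ ν x).det) (hU : DifferentiableAt ℝ U (parallel φ ν r x)) :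
    DifferentiableAt ℝ (fun s => fermiComp φ ν U s x) r := by
  set S := shape φ ν x with hS
  have hopen := isOpen_isUnit_det S
  have e : (fun s => fermiComp φ ν U s x) =ᶠ[𝓝 r]
      fun s => (1 - s • S)⁻¹ *ᵥ tangComp φ x (U (parallel φ ν s x)) := by
    filter_upwards [hopen.mem_nhds hr] with s hs
    exact h.tangComp_parallel hx hs _
  refine DifferentiableAt.congr_of_eventuallyEq ?_ e
  have hinv : ∀ i j, DifferentiableAt ℝ (fun s : ℝ => (1 - s • S)⁻¹ i j) r := by
    intro i j
    refine differentiableAt_of_contDiffOn hopen (contDiffOn_matrix_inv (fun a b => ?_)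
      (fun s hs => hs) i j) hr
    simp only [Matrix.sub_apply, Matrix.smul_apply, smul_eq_mul]
    fun_prop
  have hQ := (hasDerivAt_tangComp (φ := φ) (ν := ν) (x := x) hU).differentiableAt
  rw [differentiableAt_pi] at hQ ⊢
  intro i
  simp only [Matrix.mulVec, dotProduct]
  exact DifferentiableAt.fun_sum fun j _ => (hinv i j).fun_mul (hQ j)

lemma mulVec_fermiComp (h : IsPatch V φ ν) (hx : x ∈ V) {U : Amb n → Amb n} {r : ℝ}
    (hr : IsUnit (1 - r • shape φ ν x).det) :
    (1 - r • shape φ ν x) *ᵥ fermiComp φ ν U r x = tangComp φ x (U (parallel φ ν r x)) := by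
  rw [fermiComp, h.tangComp_parallel hx hr, Matrix.mulVec_mulVec, Matrix.mul_nonsing_inv _ hr,
    Matrix.one_mulVec]

/-- The evolution of the Fermi components, in terms of the frame of the hypersurface. -/
lemma mulVec_deriv_fermiComp (h : IsPatch V φ ν) (hx : x ∈ V) {U : Amb n → Amb n} {r : ℝ}
    (hr : IsUnit (1 - r • shape φ ν x).det) (hU : DifferentiableAt ℝ U (parallel φ ν r x)) :
    (1 - r • shape φ ν x) *ᵥ deriv (fun s => fermiComp φ ν U s x) r =
      tangComp φ x (fderiv ℝ U (parallel φ ν r x) (ν x))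
        + shape φ ν x *ᵥ fermiComp φ ν U r x := by
  set S := shape φ ν x with hS
  set W := fun s => fermiComp φ ν U s x with hW
  have hd : HasDerivAt W (deriv W r) r := (h.differentiableAt_fermiComp hx hr hU).hasDerivAt
  let L : Coord n →L[ℝ] Coord n := LinearMap.toContinuousLinearMap (Matrix.mulVecLin S)
  -- Product rule for `(1 - sS) W(s)`, which is the tangential part of `U` in the frame of `M`; this
  -- avoids differentiating the inverse matrix.
  have h1 : HasDerivAt (fun s => W s - s • L (W s))
      (deriv W r - (r • L (deriv W r) + (1 : ℝ) • L (W r))) r :=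
    hd.sub ((hasDerivAt_id r).smul (L.hasFDerivAt.comp_hasDerivAt r hd))
  have e : (fun s => W s - s • L (W s)) =ᶠ[𝓝 r] fun s => tangComp φ x (U (parallel φ ν s x)) := by
    filter_upwards [(isOpen_isUnit_det S).mem_nhds hr] with s hs
    rw [← h.mulVec_fermiComp hx hs, Matrix.sub_mulVec, Matrix.one_mulVec, Matrix.smul_mulVec]
    rfl
  have h2 := h1.unique ((hasDerivAt_tangComp hU).congr_of_eventuallyEq e)
  rw [← h2, Matrix.sub_mulVec, Matrix.one_mulVec, Matrix.smul_mulVec]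
  change _ = deriv W r - (r • S *ᵥ deriv W r + (1 : ℝ) • S *ᵥ W r) + S *ᵥ W r
  rw [one_smul]
  abel

lemma boundaryCond_iff_deriv (h : IsPatch V φ ν) (hx : x ∈ V) {U : Amb n → Amb n} {r α : ℝ}
    (hr : IsUnit (1 - r • shape φ ν x).det) (hU : DifferentiableAt ℝ U (parallel φ ν r x)) :
    BoundaryCond φ ν α U r x ↔ deriv (fun s => fermiComp φ ν U s x) r =
      (2 * α) • (shape (parallel φ ν r) ν x *ᵥ fermiComp φ ν U r x) := by
  have hd := h.differentiableAt_fermiComp hx hr hU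
  rw [funext_iff]
  refine forall_congr' fun i => ?_
  rw [deriv_pi fun i => differentiableAt_pi.1 hd i]
  rfl

/-- The boundary condition as a condition on the normal derivative. -/
lemma boundaryCond_iff (h : IsPatch V φ ν) (hx : x ∈ V) {U : Amb n → Amb n} {r α : ℝ}
    (hr : IsUnit (1 - r • shape φ ν x).det) (hU : DifferentiableAt ℝ U (parallel φ ν r x)) :
    BoundaryCond φ ν α U r x ↔ tangComp φ x (fderiv ℝ U (parallel φ ν r x) (ν x))
      = (2 * α - 1) • (shape φ ν x *ᵥ fermiComp φ ν U r x) := by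
  rw [h.boundaryCond_iff_deriv hx hr hU, h.shape_parallel hx hr]
  -- Applying the invertible `1 - rS` cancels the inverse in the parallel shape operator; the term
  -- `S W` from the moving frame shifts `2α` to `2α - 1`.
  have hinj : Function.Injective ((1 - r • shape φ ν x) *ᵥ · : Coord n → Coord n) :=
    Matrix.mulVec_injective_iff_isUnit.2 ((Matrix.isUnit_iff_isUnit_det _).2 hr)
  rw [← hinj.eq_iff]
  simp only [h.mulVec_deriv_fermiComp hx hr hU, Matrix.mulVec_smul, Matrix.mulVec_mulVec,
    ← mul_assoc, Matrix.mul_nonsing_inv _ hr, one_mul]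
  rw [← eq_sub_iff_add_eq, sub_smul, one_smul]

/-- The trace of a bilinear map in an adapted frame. -/
lemma sum_orthonormalBasis (h : IsPatch V φ ν) (hx : x ∈ V) {ι : Type*} [Fintype ι]
    (o : OrthonormalBasis ι ℝ (Amb n)) (T : Amb n →L[ℝ] Amb n →L[ℝ] Amb n) :
    ∑ a, T (o a) (o a) = T (ν x) (ν x)
      + ∑ j, ∑ k, (metric φ x)⁻¹ j k • T (pd j φ x) (pd k φ x) := by
  have hrepr : ∀ w : Amb n, ∑ a, ⟪o a, w⟫_ℝ • o a = w := o.sum_repr'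
  -- Only the second argument is split; its coefficients move to the first, where the orthonormal
  -- expansion then sums to a vector of the adapted frame.
  have e1 : ∀ a, T (o a) (o a) = ∑ k, T (tangComp φ x (o a) k • o a) (pd k φ x)
      + T (⟪o a, ν x⟫_ℝ • o a) (ν x) := by
    intro a
    rw [show T (o a) (o a) = T (o a) _ from congrArg (T (o a)) (h.eq_tangentVec_add hx (o a)),
      map_add]
    simp only [tangentVec, map_sum, map_smul, smul_apply]
  have e2 : ∀ k, ∑ a, tangComp φ x (o a) k • o a = ∑ j, (metric φ x)⁻¹ k j • pd j φ x := by
    intro k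
    simp only [tangComp, Matrix.mulVec, dotProduct, Finset.sum_smul]
    rw [Finset.sum_comm]
    refine Finset.sum_congr rfl fun j _ => ?_
    conv_rhs => rw [← hrepr (pd j φ x), Finset.smul_sum]
    exact Finset.sum_congr rfl fun a _ => by rw [smul_smul]
  have e3 : ∀ k, ∑ a, T (tangComp φ x (o a) k • o a) (pd k φ x)
      = ∑ j, (metric φ x)⁻¹ j k • T (pd j φ x) (pd k φ x) := by
    intro k
    rw [← sum_apply, ← map_sum, e2, map_sum, sum_apply]
    refine Finset.sum_congr rfl fun j _ => ?_
    rw [h.isSmoothMetric.inv_symm hx k j, map_smul, smul_apply]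
  simp only [e1, Finset.sum_add_distrib]
  rw [Finset.sum_comm]
  simp only [e3]
  rw [← sum_apply, ← map_sum, hrepr, add_comm, Finset.sum_comm]

lemma pd_pd_comp (h : IsPatch V φ ν) (hx : x ∈ V) {Ω : Set (Amb n)} {U : Amb n → Amb n}
    (hΩ : IsOpen Ω) (hU : ContDiffOn ℝ ∞ U Ω) (hφ : ∀ y ∈ V, φ y ∈ Ω) (j k : Fin n) :
    pd j (pd k fun y => U (φ y)) x = fderiv ℝ (fderiv ℝ U) (φ x) (pd j φ x) (pd k φ x)
      + fderiv ℝ U (φ x) (pd j (pd k φ) x) := by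
  have hU' : ContDiffOn ℝ ∞ (fderiv ℝ U) Ω := hU.fderiv_of_isOpen hΩ (by simp)
  have d1 : DifferentiableAt ℝ (fun y => fderiv ℝ U (φ y)) x :=
    (differentiableAt_of_contDiffOn hΩ hU' (hφ x hx)).comp x (h.differentiableAt_param hx)
  rw [pd_congr_of_eqOn (h := fun y => fderiv ℝ U (φ y) (pd k φ y)) h.isOpen (fun y hy => pd_comp
    (differentiableAt_of_contDiffOn hΩ hU (hφ y hy)) (h.differentiableAt_param hy) k) hx]
  rw [pd, fderiv_clm_apply d1 (h.differentiableAt_frame hx k)]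
  have e := pd_comp (differentiableAt_of_contDiffOn hΩ hU' (hφ x hx))
    (h.differentiableAt_param hx) j
  simp only [pd] at e ⊢
  simp [e, add_comm]

lemma trace_shape (h : IsPatch V φ ν) (hx : x ∈ V) :
    ∑ j, ∑ k, (metric φ x)⁻¹ j k * secondForm φ ν x j k = (shape φ ν x).trace := by
  have : shape φ ν x = (metric φ x)⁻¹ * secondForm φ ν x := by
    rw [h.secondForm_eq hx, ← mul_assoc, Matrix.nonsing_inv_mul _ (h.isUnit_det_metric hx), one_mul]
  rw [this]
  simp only [Matrix.trace, Matrix.diag, Matrix.mul_apply]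
  exact Finset.sum_congr rfl fun j _ => Finset.sum_congr rfl fun k _ => by
    rw [h.secondForm_symm hx j k]

lemma laplacian_eq_sum (U : Amb n → Amb n) (q : Amb n) :
    Laplacian.laplacian U q = ∑ a, fderiv ℝ (fderiv ℝ U) q (stdOrthonormalBasis ℝ (Amb n) a)
      (stdOrthonormalBasis ℝ (Amb n) a) := by
  simp [InnerProductSpace.laplacian_eq_iteratedFDeriv_stdOrthonormalBasis, iteratedFDeriv_two_apply]

/-- The tangential part of the Laplacian of an ambient field that is tangent along the
hypersurface. -/
lemma tangComp_laplacian (h : IsPatch V φ ν) (hx : x ∈ V) {Ω : Set (Amb n)} {U : Amb n → Amb n}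
    (hΩ : IsOpen Ω) (hU : ContDiffOn ℝ ∞ U Ω) (hφ : ∀ y ∈ V, φ y ∈ Ω)
    (htan : ∀ y ∈ V, ⟪U (φ y), ν y⟫_ℝ = 0) :
    tangComp φ x (Laplacian.laplacian U (φ x)) =
      tangComp φ x (fderiv ℝ (fderiv ℝ U) (φ x) (ν x) (ν x))
      + (bochnerLap (metric φ) (fun y => tangComp φ y (U (φ y))) x
        - (shape φ ν x) ^ 2 *ᵥ tangComp φ x (U (φ x)))
      - (shape φ ν x).trace • tangComp φ x (fderiv ℝ U (φ x) (ν x)) := by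
  set v := fun y => tangComp φ y (U (φ y)) with hvdef
  have hv : ∀ i, ContDiffOn ℝ ∞ (fun y => v y i) V :=
    h.contDiffOn_tangComp (hU.comp h.smooth hφ)
  have hW : ∀ y ∈ V, U (φ y) = tangentVec φ y (v y) := fun y hy =>
    (h.tangentVec_tangComp_of_tangent hy (htan y hy)).symm
  have hd := differentiableAt_of_contDiffOn hΩ hU (hφ x hx)
  have hpd : ∀ l, ∀ y ∈ V, pd l (fun y => tangentVec φ y (v y)) y = pd l (fun y => U (φ y)) y :=
    fun l y hy => pd_congr_of_eqOn h.isOpen (fun z hz => (hW z hz).symm) hy l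
  -- The ambient Hessian on the frame is the surface Hessian of the restriction, corrected by the
  -- normal part of `∂_j ∂_k φ`; traced, the correction gives `tr S · ∂_N U`.
  have e1 : ∀ j k, fderiv ℝ (fderiv ℝ U) (φ x) (pd j φ x) (pd k φ x)
      = (pd j (pd k fun y => tangentVec φ y (v y)) x
        - ∑ l, christoffel (metric φ) l j k x • pd l (fun y => tangentVec φ y (v y)) x)
        - secondForm φ ν x j k • fderiv ℝ U (φ x) (ν x) := by
    intro j k
    rw [pd_congr_of_eqOn h.isOpen (hpd k) hx, h.pd_pd_comp hx hΩ hU hφ, h.pd_frame hx]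
    simp only [hpd _ x hx, pd_comp hd (h.differentiableAt_param hx)]
    simp only [map_add, tangentVec, map_sum, map_smul]
    abel
  rw [laplacian_eq_sum, h.sum_orthonormalBasis hx]
  simp only [e1]
  rw [← h.tangComp_surfaceLap hx hv, ← h.trace_shape hx]
  simp only [smul_sub, Finset.sum_sub_distrib, ← tangCompL_apply, map_sub, map_add, map_sum,
    map_smul, Finset.sum_smul, smul_smul]
  abel

/-- The tangential part of the Laplacian of a field satisfying the boundary condition. -/
lemma tangComp_laplacian_of_boundaryCond (h : IsPatch V φ ν) (hx : x ∈ V) {Ω : Set (Amb n)}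
    {U : Amb n → Amb n} {α : ℝ} (hΩ : IsOpen Ω) (hU : ContDiffOn ℝ ∞ U Ω) (hq : φ x ∈ Ω)
    (htan : ∀ y ∈ V, φ y ∈ Ω → ⟪U (φ y), ν y⟫_ℝ = 0)
    (hbc : ∀ᶠ r in 𝓝 (0 : ℝ), BoundaryCond φ ν α U r x) :
    tangComp φ x (Laplacian.laplacian U (φ x)) =
      defLap (metric φ) (fun y => tangComp φ y (U (φ y))) x
        - (2 * α) • (ricciEnd (metric φ) x *ᵥ tangComp φ x (U (φ x)))
        - (4 * α * (1 - α)) • ((shape φ ν x) ^ 2 *ᵥ tangComp φ x (U (φ x))) := by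
  have hV' : IsOpen (V ∩ φ ⁻¹' Ω) := h.smooth.continuousOn.isOpen_inter_preimage h.isOpen hΩ
  have h' := h.mono hV' inter_subset_left
  rw [h'.tangComp_laplacian ⟨hx, hq⟩ hΩ hU (fun y hy => hy.2) (fun y hy => htan y hy.1 hy.2)]
  set S := shape φ ν x with hS
  set v := tangComp φ x (U (φ x)) with hv
  have hp0 : parallel φ ν 0 = φ := by funext y; simp [parallel]
  have hcont : ContinuousAt (fun r : ℝ => parallel φ ν r x) 0 := by
    unfold parallel; fun_prop
  have hΩr : ∀ᶠ r in 𝓝 (0 : ℝ), parallel φ ν r x ∈ Ω :=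
    hcont.eventually_mem (hΩ.mem_nhds (by rw [hp0]; exact hq))
  have hr0 : IsUnit (1 - (0 : ℝ) • S).det := by simp
  have hunit : ∀ᶠ r in 𝓝 (0 : ℝ), IsUnit (1 - r • S).det :=
    (isOpen_isUnit_det S).mem_nhds hr0
  have hd : ∀ q ∈ Ω, DifferentiableAt ℝ U q := fun q hq => differentiableAt_of_contDiffOn hΩ hU hq
  have hd0 : DifferentiableAt ℝ U (parallel φ ν 0 x) := by rw [hp0]; exact hd _ hq
  have hf0 : fermiComp φ ν U 0 x = v := by rw [fermiComp, hp0]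
  have ev : ∀ᶠ r in 𝓝 (0 : ℝ), tangComp φ x (fderiv ℝ U (parallel φ ν r x) (ν x))
      = (2 * α - 1) • (S *ᵥ fermiComp φ ν U r x) := by
    filter_upwards [hΩr, hunit, hbc] with r h1 h2 h3
    exact (h.boundaryCond_iff hx h2 (hd _ h1)).1 h3
  have first : tangComp φ x (fderiv ℝ U (φ x) (ν x)) = (2 * α - 1) • (S *ᵥ v) := by
    have := ev.self_of_nhds
    rwa [hf0, hp0] at this
  have hdf : HasDerivAt (fun s => fermiComp φ ν U s x) ((2 * α) • (S *ᵥ v)) 0 := by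
    have h1 := (h.boundaryCond_iff_deriv hx hr0 hd0).1 hbc.self_of_nhds
    rw [hf0, hp0] at h1
    rw [← h1]
    exact (h.differentiableAt_fermiComp hx hr0 hd0).hasDerivAt
  -- Here the condition is used on nearby parallel surfaces and not only on `M`: the identity `ev`
  -- is differentiated in `r` at `0`.
  have second : tangComp φ x (fderiv ℝ (fderiv ℝ U) (φ x) (ν x) (ν x))
      = (2 * α - 1) • (S *ᵥ ((2 * α) • (S *ᵥ v))) := by
    let L : Coord n →L[ℝ] Coord n := LinearMap.toContinuousLinearMap (Matrix.mulVecLin S)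
    have h1 : HasDerivAt (fun s => (2 * α - 1) • L (fermiComp φ ν U s x))
        ((2 * α - 1) • L ((2 * α) • (S *ᵥ v))) 0 :=
      (L.hasFDerivAt.comp_hasDerivAt 0 hdf).fun_const_smul _
    have hU' : ContDiffOn ℝ ∞ (fderiv ℝ U) Ω := hU.fderiv_of_isOpen hΩ (by simp)
    have hd' : DifferentiableAt ℝ (fderiv ℝ U) (parallel φ ν 0 x) := by
      rw [hp0]; exact differentiableAt_of_contDiffOn hΩ hU' hq
    have hdd : DifferentiableAt ℝ (fun q => fderiv ℝ U q (ν x)) (parallel φ ν 0 x) :=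
      hd'.clm_apply (differentiableAt_const _)
    have h2 := hasDerivAt_tangComp (φ := φ) hdd
    have h3 := h2.unique (h1.congr_of_eventuallyEq ev)
    rw [fderiv_clm_apply hd' (differentiableAt_const _), hp0] at h3
    rw [show L ((2 * α) • (S *ᵥ v)) = S *ᵥ ((2 * α) • (S *ᵥ v)) from rfl] at h3
    simpa using h3
  rw [first, second, defLap, h.ricciEnd_mulVec hx]
  simp only [Matrix.mulVec_smul, Matrix.mulVec_mulVec, ← pow_two, ← hv, ← hS]
  module

lemma continuousAt_laplacian {Ω : Set (Amb n)} {U : Amb n → Amb n} (hΩ : IsOpen Ω)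
    (hU : ContDiffOn ℝ ∞ U Ω) {q : Amb n} (hq : q ∈ Ω) :
    ContinuousAt (Laplacian.laplacian U) q := by
  have h1 : ContDiffOn ℝ ∞ (fderiv ℝ U) Ω := hU.fderiv_of_isOpen hΩ (by simp)
  have h2 : ContDiffOn ℝ ∞ (fderiv ℝ (fderiv ℝ U)) Ω := h1.fderiv_of_isOpen hΩ (by simp)
  have h3 : ContinuousAt (fderiv ℝ (fderiv ℝ U)) q :=
    h2.continuousOn.continuousAt (hΩ.mem_nhds hq)
  have : Laplacian.laplacian U = fun q => ∑ a, fderiv ℝ (fderiv ℝ U) q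
      (stdOrthonormalBasis ℝ (Amb n) a) (stdOrthonormalBasis ℝ (Amb n) a) :=
    funext fun q => laplacian_eq_sum U q
  rw [this]
  exact tendsto_finsetSum _ fun a _ => (h3.clm_apply continuousAt_const).clm_apply continuousAt_const

end IsPatch

end ThinShell

/-! ### Binomial series in a Banach algebra -/

namespace ThinShell

/-- The coefficients of the binomial series `(1 - X)^β`. -/
noncomputable def oneSubPowCoeff (β : ℝ) : ℕ → ℝ
  | 0 => 1
  | k + 1 => (k - β) / (k + 1) * oneSubPowCoeff β k

/-- Each ratio `(k - β) / (k + 1)` is at most `1 + |β|` in absolute value. The bound is crude but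
sufficient, since only small arguments are used. -/
lemma abs_oneSubPowCoeff_le (β : ℝ) (k : ℕ) : |oneSubPowCoeff β k| ≤ (1 + |β|) ^ k := by
  induction k with
  | zero => simp [oneSubPowCoeff]
  | succ k ih =>
    have hk : (0 : ℝ) < k + 1 := by positivity
    have h1 : |((k : ℝ) - β) / (k + 1)| ≤ 1 + |β| := by
      rw [abs_div, abs_of_pos hk, div_le_iff₀ hk]
      calc |(k : ℝ) - β| ≤ |(k : ℝ)| + |β| := abs_sub _ _
        _ = k + |β| := by rw [abs_of_nonneg (Nat.cast_nonneg k)]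
        _ ≤ (1 + |β|) * (k + 1) := by
          nlinarith [abs_nonneg β, mul_nonneg (abs_nonneg β) (Nat.cast_nonneg (α := ℝ) k)]
    rw [oneSubPowCoeff, abs_mul, pow_succ, mul_comm]
    exact mul_le_mul ih h1 (abs_nonneg _) (by positivity)

lemma succ_mul_oneSubPowCoeff (β : ℝ) (k : ℕ) :
    ((k + 1 : ℕ) : ℝ) * oneSubPowCoeff β (k + 1) = (k - β) * oneSubPowCoeff β k := by
  have hk : ((k : ℝ) + 1) ≠ 0 := by positivity
  rw [oneSubPowCoeff]
  push_cast
  field_simp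

section Algebra

variable {𝔸 : Type*} [NormedRing 𝔸] [NormedAlgebra ℝ 𝔸]

/-- The binomial series `(1 - X)^β` in a Banach algebra, meaningful for small `X`. -/
noncomputable def oneSubPow (β : ℝ) (X : 𝔸) : 𝔸 := ∑' k, oneSubPowCoeff β k • X ^ k

lemma oneSubPow_zero (β : ℝ) : oneSubPow β (0 : 𝔸) = 1 := by
  rw [oneSubPow, tsum_eq_single 0 fun k hk => by simp [hk]]
  simp [oneSubPowCoeff]

variable [NormOneClass 𝔸] [CompleteSpace 𝔸]

lemma contDiffOn_oneSubPow (β : ℝ) :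
    ContDiffOn ℝ ∞ (oneSubPow β : 𝔸 → 𝔸) (Metric.ball 0 (1 + |β|)⁻¹) := by
  have hpos : (0 : ℝ) < 1 + |β| := by positivity
  set p := FormalMultilinearSeries.ofScalars 𝔸 (oneSubPowCoeff β) with hp
  have hrad : ENNReal.ofReal (1 + |β|)⁻¹ ≤ p.radius := by
    refine p.le_radius_of_bound 1 (r := Real.toNNReal (1 + |β|)⁻¹) fun k => ?_
    rw [FormalMultilinearSeries.ofScalars_norm, Real.norm_eq_abs,
      Real.coe_toNNReal _ (inv_nonneg.2 hpos.le), inv_pow]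
    rw [mul_inv_le_iff₀ (pow_pos hpos k), one_mul]
    exact abs_oneSubPowCoeff_le β k
  have hsum : p.sum = oneSubPow β := FormalMultilinearSeries.ofScalarsSum_eq_tsum _
  have hps := p.hasFPowerSeriesOnBall (lt_of_lt_of_le (by simpa using hpos) hrad)
  rw [hsum] at hps
  refine (hps.analyticOnNhd.contDiffOn Metric.isOpen_eball.uniqueDiffOn).mono ?_
  rw [← Metric.eball_ofReal]
  exact Metric.eball_subset_eball hrad

/-- The differential equation satisfied by `r ↦ (1 - r B)^β`. -/
lemma hasDerivAt_oneSubPow (β : ℝ) (B : 𝔸) {R r : ℝ} (hR : 0 < R)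
    (hRB : R * ((1 + |β|) * ‖B‖) < 1) (hr : |r| < R) :
    ∃ D : 𝔸, HasDerivAt (fun s : ℝ => oneSubPow β (s • B)) D r ∧
      (1 - r • B) * D = -(β • (B * oneSubPow β (r • B))) := by
  set c := oneSubPowCoeff β with hc
  set b := (1 + |β|) * ‖B‖ with hb
  have hb0 : 0 ≤ b := by positivity
  have hnorm : ∀ k, ‖c k • B ^ k‖ ≤ b ^ k := fun k => by
    rw [norm_smul, hb, mul_pow]
    exact mul_le_mul (abs_oneSubPowCoeff_le β k) (norm_pow_le B k) (norm_nonneg _) (by positivity)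
  -- A majorant for the differentiated series on `|s| < R`; at `k = 0` the truncated exponent `k -
  -- 1` is harmless because of the factor `k`.
  have hu : Summable fun k : ℕ => (k : ℝ) * R ^ (k - 1) * b ^ k := by
    have h1 := summable_pow_mul_geometric_of_norm_lt_one 1 (r := R * b)
      (by rwa [Real.norm_eq_abs, abs_of_nonneg (by positivity)])
    refine (h1.mul_left R⁻¹).congr fun k => ?_
    cases k with
    | zero => simp
    | succ k => rw [Nat.add_sub_cancel, mul_pow, pow_succ R, pow_one]; field_simp
  have hder : ∀ (k : ℕ), ∀ s ∈ Metric.ball (0 : ℝ) R, HasDerivAt (fun s : ℝ => s ^ k • (c k • B ^ k))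
      (((k : ℝ) * s ^ (k - 1)) • (c k • B ^ k)) s := fun k s _ =>
    (hasDerivAt_pow k s).smul_const _
  have hbound : ∀ (k : ℕ), ∀ s ∈ Metric.ball (0 : ℝ) R,
      ‖((k : ℝ) * s ^ (k - 1)) • (c k • B ^ k)‖ ≤ (k : ℝ) * R ^ (k - 1) * b ^ k := by
    intro k s hs
    have hs' : |s| ≤ R := by simpa using (mem_ball_zero_iff.1 hs).le
    rw [norm_smul, norm_mul, norm_pow, Real.norm_eq_abs, Real.norm_eq_abs, Nat.abs_cast]
    gcongr
    exact hnorm k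
  have hrmem : r ∈ Metric.ball (0 : ℝ) R := by simpa using hr
  have h0 : Summable fun k : ℕ => (0 : ℝ) ^ k • (c k • B ^ k) :=
    summable_of_ne_finset_zero (s := {0}) fun k hk => by
      rw [zero_pow (by simpa using hk), zero_smul]
  have hconv := (convex_ball (0 : ℝ) R).isPreconnected
  have hmain := hasDerivAt_tsum_of_isPreconnected hu Metric.isOpen_ball hconv hder hbound
    (Metric.mem_ball_self hR) h0 hrmem
  have hval := summable_of_summable_hasDerivAt_of_isPreconnected hu Metric.isOpen_ball hconv hder
    hbound (Metric.mem_ball_self hR) h0 hrmem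
  have hfun : (fun s : ℝ => oneSubPow β (s • B)) = fun s => ∑' k, s ^ k • (c k • B ^ k) := by
    funext s
    rw [oneSubPow]
    exact tsum_congr fun k => by rw [smul_pow, smul_comm]
  refine ⟨_, hfun ▸ hmain, ?_⟩
  have hd : Summable fun k : ℕ => ((k : ℝ) * r ^ (k - 1)) • (c k • B ^ k) :=
    hu.of_norm_bounded fun k => hbound k r hrmem
  have s1 := hd.hasSum
  set D := ∑' k : ℕ, ((k : ℝ) * r ^ (k - 1)) • (c k • B ^ k) with hD
  -- Shifting the index past the vanishing term `k = 0` and using the coefficient recursion puts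
  -- `D`, `r B D` and `B (1 - rB)^β` on the same powers `B ^ (k + 1)`, so the equation can be
  -- compared termwise.
  have s2 : HasSum (fun k : ℕ => ((k - β) * c k * r ^ k) • B ^ (k + 1)) D := by
    have := (hasSum_nat_add_iff' 1).2 s1
    simp only [Finset.range_one, Finset.sum_singleton, Nat.cast_zero, zero_mul, zero_smul,
      sub_zero] at this
    refine this.congr_fun fun k => ?_
    rw [Nat.add_sub_cancel, smul_smul]
    congr 1
    linear_combination -r ^ k * succ_mul_oneSubPowCoeff β k
  have s3 : HasSum (fun k : ℕ => ((k : ℝ) * c k * r ^ k) • B ^ (k + 1)) (r • B * D) := by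
    refine (s1.mul_left (r • B)).congr_fun fun k => ?_
    rw [smul_mul_smul_comm, mul_smul_comm, ← pow_succ', smul_smul]
    congr 1
    cases k with
    | zero => simp
    | succ k => rw [Nat.add_sub_cancel]; ring
  have s4 : HasSum (fun k : ℕ => (c k * r ^ k) • B ^ (k + 1)) (B * oneSubPow β (r • B)) := by
    have hv := hval.hasSum
    rw [← congrFun hfun r] at hv
    refine (hv.mul_left B).congr_fun fun k => ?_
    rw [mul_smul_comm, mul_smul_comm, ← pow_succ', smul_smul, mul_comm]
  have s5 := s2.sub s3
  have s6 := (s4.const_smul β).neg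
  rw [sub_mul, one_mul]
  refine s5.unique (s6.congr_fun fun k => ?_)
  rw [smul_smul, ← sub_smul, ← neg_smul]
  congr 1
  ring

end Algebra

end ThinShell

/-! ### Fermi coordinates as a local diffeomorphism -/

namespace ThinShell

variable {n : ℕ}

/-- The inverse function theorem, with a smooth inverse on the whole target. -/
lemma exists_openPartialHomeomorph {E F : Type*} [NormedAddCommGroup E] [NormedSpace ℝ E]
    [CompleteSpace E] [NormedAddCommGroup F] [NormedSpace ℝ F] {f : E → F} {O : Set E} {a : E}
    (hO : IsOpen O) (hf : ContDiffOn ℝ ∞ f O) (ha : a ∈ O) (e : E ≃L[ℝ] F)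
    (he : HasFDerivAt f (e : E →L[ℝ] F) a) :
    ∃ G : OpenPartialHomeomorph E F, a ∈ G.source ∧ G.source ⊆ O ∧ (∀ p, G p = f p) ∧
      ContDiffOn ℝ ∞ G.symm G.target := by
  -- Restricting to the open set of points with invertible derivative makes the inverse smooth on
  -- the whole target, not just at the image of `a`.
  set O' := O ∩ fderiv ℝ f ⁻¹' Set.range (fun e : E ≃L[ℝ] F => (e : E →L[ℝ] F)) with hO'
  have hopen : IsOpen O' :=
    (hf.fderiv_of_isOpen hO (m := ∞) (by simp)).continuousOn.isOpen_inter_preimage hO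
      ContinuousLinearEquiv.isOpen
  have ha' : a ∈ O' := ⟨ha, e, he.fderiv.symm⟩
  have hfa := hf.contDiffAt (hO.mem_nhds ha)
  set G₀ := hfa.toOpenPartialHomeomorph f he (by simp) with hG₀
  refine ⟨G₀.restrOpen O' hopen, ⟨hfa.mem_toOpenPartialHomeomorph_source he (by simp), ha'⟩,
    fun p hp => ?_, fun p => rfl, fun q hq => ?_⟩
  · rw [OpenPartialHomeomorph.restrOpen_source] at hp
    exact hp.2.1
  · set G := G₀.restrOpen O' hopen
    have hmem : G.symm q ∈ O' := by
      have := G.map_target hq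
      rw [OpenPartialHomeomorph.restrOpen_source] at this
      exact this.2
    obtain ⟨hm1, e', he'⟩ := hmem
    have hfq := hf.contDiffAt (hO.mem_nhds hm1)
    refine (G.contDiffAt_symm (f₀' := e') hq ?_ hfq).contDiffWithinAt
    rw [show ((e' : E →L[ℝ] F)) = fderiv ℝ f (G.symm q) from he']
    exact (hfq.differentiableAt (by simp)).hasFDerivAt

variable {V : Set (Coord n)} {φ ν : Coord n → Amb n} {x : Coord n}

lemma IsOrientedHypersurface.isPatch {M : Set (Amb n)} {N : Amb n → Amb n}
    (hM : IsOrientedHypersurface M N) (hφ : IsLocalParam M V φ) : IsPatch V φ (N ∘ φ) where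
  isOpen := hφ.isOpen
  smooth := hφ.smooth
  immersion := hφ.immersion
  smooth_normal := hM.smooth V φ hφ
  unit x hx := by
    obtain ⟨W, -, hW⟩ := hφ.image
    exact hM.unit _ (hW ▸ Set.mem_image_of_mem φ hx : φ x ∈ M ∩ W).1
  normal := hM.normal V φ hφ

lemma IsLocalParam.mem {M : Set (Amb n)} (hφ : IsLocalParam M V φ) (hx : x ∈ V) : φ x ∈ M := by
  obtain ⟨W, -, hW⟩ := hφ.image
  exact (hW ▸ Set.mem_image_of_mem φ hx : φ x ∈ M ∩ W).1

/-- Open subsets of the parameter domain parametrize relatively open subsets. -/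
lemma IsLocalParam.exists_isOpen_inter {M : Set (Amb n)} (hφ : IsLocalParam M V φ)
    {V₁ : Set (Coord n)} (hV₁ : IsOpen V₁) :
    ∃ W, IsOpen W ∧ (∀ y ∈ V₁ ∩ V, φ y ∈ W) ∧ ∀ q ∈ M ∩ W, ∃ y ∈ V₁ ∩ V, φ y = q := by
  obtain ⟨W, hW, himg⟩ := hφ.image
  obtain ⟨W₁, hW₁, hpre⟩ := hφ.embedding.isOpen_iff.1 (hV₁.preimage continuous_subtype_val)
  have hiff : ∀ y (hy : y ∈ V), φ y ∈ W₁ ↔ y ∈ V₁ := fun y hy => by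
    have : (⟨y, hy⟩ : V) ∈ V.domRestrict φ ⁻¹' W₁ ↔ (⟨y, hy⟩ : V) ∈ Subtype.val ⁻¹' V₁ := by
      rw [hpre]
    exact this
  refine ⟨W ∩ W₁, hW.inter hW₁, fun y hy => ⟨?_, (hiff y hy.2).2 hy.1⟩, fun q hq => ?_⟩
  · exact (himg ▸ Set.mem_image_of_mem φ hy.2 : φ y ∈ M ∩ W).2
  · obtain ⟨y, hy, rfl⟩ : q ∈ φ '' V := himg ▸ ⟨hq.1, hq.2.1⟩
    exact ⟨y, ⟨(hiff y hy).1 hq.2.2, hy⟩, rfl⟩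

namespace IsPatch

lemma contDiffOn_fermi (h : IsPatch V φ ν) :
    ContDiffOn ℝ ∞ (fun p : ℝ × Coord n => parallel φ ν p.1 p.2) (univ ×ˢ V) := by
  unfold parallel
  have hs : MapsTo (Prod.snd : ℝ × Coord n → Coord n) (univ ×ˢ V) V := fun p hp => hp.2
  exact (h.smooth.comp contDiffOn_snd hs).add
    (contDiffOn_fst.smul (h.smooth_normal.comp contDiffOn_snd hs))

lemma fderiv_apply_eq_tangentVec (f : Coord n → Amb n) (x w : Coord n) :
    fderiv ℝ f x w = tangentVec f x w := by
  conv_lhs => rw [pi_eq_sum_univ' w, map_sum]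
  refine Finset.sum_congr rfl fun i _ => ?_
  rw [map_smul, pd]

/-- The Fermi coordinate map is a local diffeomorphism near the hypersurface. -/
lemma exists_equiv_fermi (h : IsPatch V φ ν) (hx : x ∈ V) :
    ∃ e : (ℝ × Coord n) ≃L[ℝ] Amb n,
      HasFDerivAt (fun p : ℝ × Coord n => parallel φ ν p.1 p.2) (e : _ →L[ℝ] Amb n) (0, x) := by
  let L : ℝ × Coord n →L[ℝ] Amb n :=
    (ContinuousLinearMap.toSpanSingleton ℝ (ν x)).coprod (tangentVecL φ x)
  have hL : HasFDerivAt (fun p : ℝ × Coord n => parallel φ ν p.1 p.2) L (0, x) := by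
    have h1 : HasFDerivAt (fun p : ℝ × Coord n => φ p.2)
        ((fderiv ℝ φ x).comp (ContinuousLinearMap.snd ℝ ℝ (Coord n))) (0, x) :=
      HasFDerivAt.comp (g := φ) (0, x) (h.differentiableAt_param hx).hasFDerivAt hasFDerivAt_snd
    have h2 : HasFDerivAt (fun p : ℝ × Coord n => ν p.2)
        ((fderiv ℝ ν x).comp (ContinuousLinearMap.snd ℝ ℝ (Coord n))) (0, x) :=
      HasFDerivAt.comp (g := ν) (0, x) (h.differentiableAt_normal hx).hasFDerivAt hasFDerivAt_snd
    have h3 := h1.add ((hasFDerivAt_fst (𝕜 := ℝ) (p := ((0 : ℝ), x))).smul h2)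
    refine h3.congr_fderiv ?_
    ext p
    · simp [L]
    · simp [L, fderiv_apply_eq_tangentVec]
  have hinj : Function.Injective (L : ℝ × Coord n →ₗ[ℝ] Amb n) := by
    rw [injective_iff_map_eq_zero]
    rintro ⟨s, w⟩ hw
    have hw' : s • ν x + tangentVec φ x w = 0 := by simpa [L] using hw
    have hs : s = 0 := by
      have := congrArg (fun z => ⟪z, ν x⟫_ℝ) hw'
      simpa only [inner_add_left, real_inner_smul_left, h.inner_normal_normal hx,
        h.inner_tangentVec_normal hx, mul_one, add_zero, inner_zero_left] using this
    rw [hs, zero_smul, zero_add] at hw'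
    have := h.tangComp_tangentVec hx w
    rw [hw', ← tangCompL_apply, map_zero] at this
    rw [hs, ← this]
    rfl
  let e := ((L : ℝ × Coord n →ₗ[ℝ] Amb n).linearEquivOfInjective hinj
    (by simp [add_comm])).toContinuousLinearEquiv
  refine ⟨e, ?_⟩
  have : (e : ℝ × Coord n →L[ℝ] Amb n) = L := by ext p <;> rfl
  rw [this]
  exact hL

/-- A differential equation in the ambient space that implies the boundary condition. -/
lemma boundaryCond_of_hasDerivAt (h : IsPatch V φ ν) (hx : x ∈ V) {U : Amb n → Amb n}
    {r α : ℝ} (hr : IsUnit (1 - r • shape φ ν x).det)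
    (hU : DifferentiableAt ℝ U (parallel φ ν r x)) {B : Amb n →L[ℝ] Amb n}
    (hB : ∀ i, B (pd i φ x) = -pd i ν x) (hBν : B (ν x) = 0) {D : Amb n}
    (hD : HasDerivAt (fun s => U (parallel φ ν s x)) D r)
    (hode : D - r • B D = (2 * α - 1) • B (U (parallel φ ν r x))) :
    BoundaryCond φ ν α U r x := by
  -- The hypotheses on `B` say that it is the shape operator on tangent vectors and zero on the
  -- normal.
  have hBt : ∀ w, tangComp φ x (B w) = shape φ ν x *ᵥ tangComp φ x w := by
    intro w
    have h1 : B w = tangentVec φ x (shape φ ν x *ᵥ tangComp φ x w) := by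
      conv_lhs => rw [h.eq_tangentVec_add hx w]
      rw [map_add, map_smul, hBν, smul_zero, add_zero]
      rw [pi_eq_sum_univ' (tangComp φ x w)]
      simp only [← tangentVecL_apply, map_sum, map_smul, Matrix.mulVec_sum, Matrix.mulVec_smul]
      refine Finset.sum_congr rfl fun i _ => ?_
      rw [tangentVecL_apply, tangentVecL_apply, tangentVec_single, hB, h.pd_normal hx, neg_neg]
    rw [h1, h.tangComp_tangentVec hx]
  have hD' : tangComp φ x (fderiv ℝ U (parallel φ ν r x) (ν x)) = tangComp φ x D :=
    (hasDerivAt_tangComp hU).unique ((tangCompL φ x).hasFDerivAt.comp_hasDerivAt r hD)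
  rw [h.boundaryCond_iff hx hr hU, hD']
  have hinj : Function.Injective ((1 - r • shape φ ν x) *ᵥ · : Coord n → Coord n) :=
    Matrix.mulVec_injective_iff_isUnit.2 ((Matrix.isUnit_iff_isUnit_det _).2 hr)
  apply hinj
  have h1 := congrArg (tangCompL φ x) hode
  simp only [map_sub, map_smul, tangCompL_apply, hBt, ← h.mulVec_fermiComp hx hr] at h1
  simp only [Matrix.mulVec_smul]
  rw [Matrix.sub_mulVec, Matrix.one_mulVec, Matrix.smul_mulVec, h1]
  congr 1
  rw [Matrix.mulVec_mulVec, Matrix.mulVec_mulVec, mul_sub, sub_mul, mul_one, one_mul,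
    Matrix.smul_mul, Matrix.mul_smul]

end IsPatch

end ThinShell

/-! ### Existence of extensions and the effective operator -/

namespace ThinShell

variable {n : ℕ} {V : Set (Coord n)} {φ : Coord n → Amb n} {x : Coord n}
  {M : Set (Amb n)} {N : Amb n → Amb n}

/-- Existence of an ambient extension satisfying the boundary condition. -/
theorem exists_isShellExtension (hM : IsOrientedHypersurface M N) (hφ : IsLocalParam M V φ)
    (hx : x ∈ V) (α : ℝ) {u : Amb n → Amb n} (hu : IsTangentField M N u) :
    ∃ Ω U, φ x ∈ Ω ∧ IsShellExtension M N α u Ω U := by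
  have h := hM.isPatch hφ
  set ν := N ∘ φ with hν
  obtain ⟨e, he⟩ := h.exists_equiv_fermi hx
  obtain ⟨G, hG0, hGsub, hGf, hGsymm⟩ := exists_openPartialHomeomorph
    (isOpen_univ.prod h.isOpen) h.contDiffOn_fermi ⟨mem_univ _, hx⟩ e he
  -- The exponent for which `(1 - rB)^β u` solves `(1 - rB) ∂_r U = (2α - 1) B U`.
  set β : ℝ := 1 - 2 * α with hβ
  set ρ : Amb n → ℝ := fun q => (G.symm q).1 with hρ
  set ξ : Amb n → Coord n := fun q => (G.symm q).2 with hξ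
  have hρs : ContDiffOn ℝ ∞ ρ G.target := hGsymm.fst
  have hξs : ContDiffOn ℝ ∞ ξ G.target := hGsymm.snd
  have hξV : ∀ q ∈ G.target, ξ q ∈ V := fun q hq => (hGsub (G.map_target hq)).2
  set V₁ : Set (Coord n) := {y | ((0 : ℝ), y) ∈ G.source} with hV₁
  have hV₁o : IsOpen V₁ := G.open_source.preimage (by fun_prop)
  have hφG : ∀ y, φ y = G (0, y) := fun y => by simp [hGf, parallel]
  have hV₁t : ∀ y ∈ V₁, φ y ∈ G.target := fun y hy => hφG y ▸ G.map_source hy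
  have hsymm : ∀ y ∈ V₁, G.symm (φ y) = (0, y) := fun y hy => by
    rw [hφG, G.left_inv hy]
  have hV₁V : V₁ ⊆ V := fun y hy => (hGsub hy).2
  -- Intersecting with `W` keeps out other pieces of `M` that may enter the Fermi neighbourhood;
  -- there `U` would have no reason to equal `u`.
  obtain ⟨W, hWo, hW1, hW2⟩ := hφ.exists_isOpen_inter hV₁o
  -- The normal extended constantly along normal lines; minus its derivative is the chart-free
  -- operator `B`, which annihilates the normal.
  set Nt : Amb n → Amb n := fun q => ν (ξ q) with hNt
  have hNts : ContDiffOn ℝ ∞ Nt G.target := h.smooth_normal.comp hξs hξV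
  set B : Coord n → Amb n →L[ℝ] Amb n := fun y => -fderiv ℝ Nt (φ y) with hB
  have hBs : ContDiffOn ℝ ∞ B V₁ :=
    ((hNts.fderiv_of_isOpen G.open_target (m := ∞) (by simp)).comp (h.smooth.mono hV₁V)
      hV₁t).neg
  set T : Set (Amb n) := (G.target ∩ ξ ⁻¹' V₁) ∩ W with hT
  have hTo : IsOpen T :=
    (hξs.continuousOn.isOpen_inter_preimage G.open_target hV₁o).inter hWo
  have hTt : T ⊆ G.target := fun q hq => hq.1.1
  set X : Amb n → Amb n →L[ℝ] Amb n := fun q => ρ q • B (ξ q) with hX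
  have hXs : ContDiffOn ℝ ∞ X T :=
    (hρs.mono hTt).smul (hBs.comp (hξs.mono hTt) fun q hq => hq.1.2)
  set Ω : Set (Amb n) := T ∩ X ⁻¹' Metric.ball 0 (1 + |β|)⁻¹ with hΩ
  have hΩo : IsOpen Ω := hXs.continuousOn.isOpen_inter_preimage hTo Metric.isOpen_ball
  set U : Amb n → Amb n := fun q => oneSubPow β (X q) (u (φ (ξ q))) with hU
  have hUs : ContDiffOn ℝ ∞ U Ω := by
    refine ContDiffOn.clm_apply ?_ ?_
    · exact (contDiffOn_oneSubPow β).comp (hXs.mono inter_subset_left) fun q hq => hq.2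
    · exact (hu.smooth V φ hφ).comp (hξs.mono fun q hq => hTt hq.1) fun q hq => hξV q (hTt hq.1)
  have hMΩ : ∀ q ∈ M ∩ Ω, ∃ y ∈ V₁, φ y = q := fun q hq => by
    obtain ⟨y, hy, rfl⟩ := hW2 q ⟨hq.1, hq.2.1.2⟩
    exact ⟨y, hy.1, rfl⟩
  have hfix : ∀ q ∈ M ∩ Ω, φ (ξ q) = q := fun q hq => by
    obtain ⟨y, hy, rfl⟩ := hMΩ q hq
    simp only [hξ, hsymm y hy]
  have hX0 : ∀ y ∈ V₁, X (φ y) = 0 := fun y hy => by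
    change (G.symm (φ y)).1 • B (ξ (φ y)) = 0
    rw [hsymm y hy]
    exact zero_smul ℝ (B _)
  refine ⟨Ω, U, ⟨⟨⟨hV₁t x hG0, ?_⟩, hW1 x ⟨hG0, hx⟩⟩, ?_⟩, hΩo, hUs, fun q hq => ?_, ?_⟩
  · simp only [mem_preimage, hξ, hsymm x hG0]
    exact hG0
  · rw [mem_preimage, hX0 x hG0]
    exact Metric.mem_ball_self (inv_pos.2 (by positivity))
  · obtain ⟨y, hy, rfl⟩ := hMΩ q hq
    change oneSubPow β (X (φ y)) (u (φ (ξ (φ y)))) = _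
    rw [hX0 y hy, oneSubPow_zero, hfix _ hq]
    rfl
  -- The condition is required in every parametrization of `M`. The normal line through a point does
  -- not depend on the parametrization, so `U` along it is still given by the explicit formula in
  -- `r`.
  · intro V' φ' hφ' x' hx' hxΩ
    have h' := hM.isPatch hφ'
    have hmem : φ' x' ∈ M ∩ Ω := ⟨hφ'.mem hx', hxΩ⟩
    obtain ⟨y, hy, hyx⟩ := hMΩ _ hmem
    have hp : ∀ r, parallel φ' (N ∘ φ') r x' = G (r, y) := fun r => by
      rw [hGf, parallel, parallel, hν, Function.comp_apply, Function.comp_apply, hyx]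
    have hsrc : ∀ᶠ r in 𝓝 (0 : ℝ), (r, y) ∈ G.source := by
      have : ContinuousAt (fun r : ℝ => (r, y)) 0 := by fun_prop
      exact this.eventually_mem (G.open_source.mem_nhds hy)
    have hUp : ∀ r, (r, y) ∈ G.source →
        U (parallel φ' (N ∘ φ') r x') = oneSubPow β (r • B y) (u (φ y)) := fun r hr => by
      simp only [hU, hX, hρ, hξ, hp, G.left_inv hr]
    have hNtd : DifferentiableAt ℝ Nt (φ' x') :=
      differentiableAt_of_contDiffOn G.open_target hNts (hTt hxΩ.1)
    have hB1 : ∀ i, B y (pd i φ' x') = -pd i (N ∘ φ') x' := fun i => by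
      have hev : N ∘ φ' =ᶠ[𝓝 x'] fun z => Nt (φ' z) := by
        have hc := (h'.differentiableAt_param hx').continuousAt
        filter_upwards [hc.eventually_mem (hΩo.mem_nhds hxΩ), h'.isOpen.mem_nhds hx'] with z hz hz'
        simp only [hNt, hν, Function.comp_apply, hfix _ ⟨hφ'.mem hz', hz⟩]
      have : pd i (N ∘ φ') x' = pd i (fun z => Nt (φ' z)) x' := by
        simp only [pd, hev.fderiv_eq]
      rw [this, pd_comp hNtd (h'.differentiableAt_param hx')]
      simp only [hB, hyx]
      rfl
    have hB2 : B y ((N ∘ φ') x') = 0 := by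
      have h1 : HasDerivAt (fun r : ℝ => parallel φ' (N ∘ φ') r x') ((N ∘ φ') x') 0 := by
        simpa [parallel] using ((hasDerivAt_id (0 : ℝ)).smul_const ((N ∘ φ') x')).const_add (φ' x')
      have hp0 : parallel φ' (N ∘ φ') 0 x' = φ' x' := by simp [parallel]
      have h0 : HasFDerivAt Nt (fderiv ℝ Nt (φ' x')) (parallel φ' (N ∘ φ') 0 x') := by
        rw [hp0]
        exact hNtd.hasFDerivAt
      have h2 := h0.comp_hasDerivAt (0 : ℝ) h1
      have h3 : (fun r : ℝ => Nt (parallel φ' (N ∘ φ') r x')) =ᶠ[𝓝 0] fun _ => ν y := by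
        filter_upwards [hsrc] with r hr
        simp only [hNt, hξ, hp, G.left_inv hr]
      have h4 := h2.unique ((hasDerivAt_const (0 : ℝ) (ν y)).congr_of_eventuallyEq h3)
      simp only [hB, hyx]
      rw [neg_apply, h4, neg_zero]
    -- Any positive radius inside the convergence domain would do; the `+ 1` covers `B y = 0`.
    set R : ℝ := (2 * ((1 + |β|) * ‖B y‖ + 1))⁻¹ with hR
    have hRpos : 0 < R := by positivity
    have hRB : R * ((1 + |β|) * ‖B y‖) < 1 := by
      have hb : 0 ≤ (1 + |β|) * ‖B y‖ := by positivity
      rw [hR, inv_mul_lt_iff₀ (by positivity)]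
      linarith
    have hpc : ContinuousAt (fun r : ℝ => parallel φ' (N ∘ φ') r x') 0 := by
      unfold parallel; fun_prop
    have hΩr : ∀ᶠ r in 𝓝 (0 : ℝ), parallel φ' (N ∘ φ') r x' ∈ Ω :=
      hpc.eventually_mem (hΩo.mem_nhds (by simpa [parallel] using hxΩ))
    have hunit : ∀ᶠ r in 𝓝 (0 : ℝ), IsUnit (1 - r • shape φ' (N ∘ φ') x').det :=
      (IsPatch.isOpen_isUnit_det _).mem_nhds (by simp)
    have hRr : ∀ᶠ r in 𝓝 (0 : ℝ), |r| < R := by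
      filter_upwards [Metric.ball_mem_nhds (0 : ℝ) hRpos] with r hr
      simpa using hr
    -- The formula for `U` is needed on a neighbourhood of `r`, as it will be differentiated there.
    filter_upwards [hΩr, hunit, hRr, hsrc.eventually_nhds] with r h1 h2 h3 h4
    obtain ⟨D, hD, hode⟩ := hasDerivAt_oneSubPow β (B y) hRpos hRB h3
    refine h'.boundaryCond_of_hasDerivAt (B := B y) (D := D (u (φ y))) hx' h2
      (differentiableAt_of_contDiffOn hΩo hUs h1) hB1 hB2 ?_ ?_
    · have hD' : HasDerivAt (fun s : ℝ => oneSubPow β (s • B y) (u (φ y))) (D (u (φ y))) r :=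
        (ContinuousLinearMap.apply ℝ (Amb n) (u (φ y))).hasFDerivAt.comp_hasDerivAt r hD
      refine hD'.congr_of_eventuallyEq ?_
      filter_upwards [h4] with s hs
      exact hUp s hs
    · rw [hUp r h4.self_of_nhds]
      have := congrArg (fun L : Amb n →L[ℝ] Amb n => L (u (φ y))) hode
      simp only [sub_mul, one_mul, smul_mul_assoc] at this
      have hα : 2 * α - 1 = -β := by rw [hβ]; ring
      rw [hα, neg_smul]
      exact this

lemma covDeriv_congr {g : Coord n → Matrix (Fin n) (Fin n) ℝ} {v w : Coord n → Coord n}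
    (hvw : v =ᶠ[𝓝 x] w) (k i : Fin n) : covDeriv g v k i x = covDeriv g w k i x := by
  have hi : (fun z => v z i) =ᶠ[𝓝 x] fun z => w z i :=
    hvw.mono fun z hz => congrFun hz i
  simp only [covDeriv, pd, hi.fderiv_eq, hvw.self_of_nhds]

lemma defLap_congr {g : Coord n → Matrix (Fin n) (Fin n) ℝ} {v w : Coord n → Coord n}
    (hvw : v =ᶠ[𝓝 x] w) : defLap g v x = defLap g w x := by
  have h1 : ∀ k i, covDeriv g v k i =ᶠ[𝓝 x] covDeriv g w k i := fun k i =>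
    hvw.eventually_nhds.mono fun y hy => covDeriv_congr hy k i
  have h2 : ∀ j k i, covDeriv₂ g v j k i x = covDeriv₂ g w j k i x := fun j k i => by
    simp only [covDeriv₂, covDeriv_congr hvw, pd, (h1 k i).fderiv_eq]
  rw [defLap, defLap, hvw.self_of_nhds]
  congr 1
  funext i
  simp only [bochnerLap, h2]

/-- The value of the effective operator. -/
theorem isEffectiveValue (hM : IsOrientedHypersurface M N) (hφ : IsLocalParam M V φ)
    (hx : x ∈ V) (α : ℝ) {u : Amb n → Amb n} (hu : IsTangentField M N u) :
    IsEffectiveValue M N α u (φ x) (tangentVec φ x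
      (defLap (metric φ) (fun y => tangComp φ y (u (φ y))) x
        - (2 * α) • (ricciEnd (metric φ) x *ᵥ tangComp φ x (u (φ x)))
        - (4 * α * (1 - α)) • ((shape φ (N ∘ φ) x) ^ 2 *ᵥ tangComp φ x (u (φ x))))) := by
  refine ⟨exists_isShellExtension hM hφ hx α hu, fun Ω U hq hU => ?_⟩
  have h := hM.isPatch hφ
  have hV' : IsOpen (V ∩ φ ⁻¹' Ω) :=
    h.smooth.continuousOn.isOpen_inter_preimage h.isOpen hU.isOpen
  have h' := h.mono hV' inter_subset_left
  have hUu : ∀ y ∈ V ∩ φ ⁻¹' Ω, U (φ y) = u (φ y) := fun y hy =>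
    hU.restrict _ ⟨hφ.mem hy.1, hy.2⟩
  have htan : ∀ y ∈ V, φ y ∈ Ω → ⟪U (φ y), (N ∘ φ) y⟫_ℝ = 0 := fun y hy hy' => by
    rw [hUu y ⟨hy, hy'⟩]
    exact hu.tangent _ (hφ.mem hy)
  have key := h.tangComp_laplacian_of_boundaryCond hx hU.isOpen hU.smooth hq htan
    (hU.boundary V φ hφ x hx hq)
  -- `U` and `u` agree only on `M ∩ Ω`, so the operator is compared through its locality.
  have hdef : defLap (metric φ) (fun y => tangComp φ y (U (φ y))) x
      = defLap (metric φ) (fun y => tangComp φ y (u (φ y))) x := by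
    refine defLap_congr ?_
    filter_upwards [hV'.mem_nhds ⟨hx, hq⟩] with y hy
    rw [hUu y hy]
  rw [hdef, hUu x ⟨hx, hq⟩] at key
  rw [← key, h.tangentVec_tangComp hx]
  have hc1 : ContinuousAt (fun r : ℝ => φ x + r • N (φ x)) 0 := by fun_prop
  have hc2 : ContinuousAt (Laplacian.laplacian U) (φ x + (0 : ℝ) • N (φ x)) := by
    rw [zero_smul, add_zero]
    exact IsPatch.continuousAt_laplacian hU.isOpen hU.smooth hq
  have hc3 : ContinuousAt (fun r : ℝ => Laplacian.laplacian U (φ x + r • N (φ x))) 0 :=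
    ContinuousAt.comp (g := Laplacian.laplacian U) hc2 hc1
  have hc4 : Continuous (tangentialPart (N (φ x)) : Amb n → Amb n) := by
    unfold tangentialPart; fun_prop
  have hc5 := (hc4.continuousAt.comp hc3).tendsto
  simpa [Function.comp_def] using hc5

/-- Effective values are unique. -/
lemma IsEffectiveValue.unique {α : ℝ} {u : Amb n → Amb n} {p w w' : Amb n}
    (hw : IsEffectiveValue M N α u p w) (hw' : IsEffectiveValue M N α u p w') : w = w' := by
  obtain ⟨Ω, U, hp, hU⟩ := hw.1
  exact tendsto_nhds_unique (hw.2 Ω U hp hU) (hw'.2 Ω U hp hU)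

/-- The tangential part of a constant vector is a smooth tangent field. -/
lemma isTangentField_tangentialPart (hM : IsOrientedHypersurface M N) (w : Amb n) :
    IsTangentField M N fun q => tangentialPart (N q) w where
  smooth V φ hφ := by
    have hN := hM.smooth V φ hφ
    exact contDiffOn_const.sub ((contDiffOn_const.inner ℝ hN).smul hN)
  tangent p hp := by
    simp only [tangentialPart, inner_sub_left, real_inner_smul_left, real_inner_self_eq_norm_sq,
      hM.unit p hp]
    ring

/-- A shape operator with vanishing square vanishes. -/
lemma IsPatch.shape_eq_zero_of_sq {ν : Coord n → Amb n} (h : IsPatch V φ ν) (hx : x ∈ V)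
    (hsq : (shape φ ν x) ^ 2 = 0) : shape φ ν x = 0 := by
  set S := shape φ ν x with hS
  have key : ∀ v, S *ᵥ v = 0 := fun v => by
    -- Self-adjointness: `⟨Sv, Sv⟩ = ⟨v, S²v⟩`.
    have h1 : ⟪tangentVec φ x (S *ᵥ v), tangentVec φ x (S *ᵥ v)⟫_ℝ = 0 := by
      have e : ∀ z, (S *ᵥ v) ⬝ᵥ z = v ⬝ᵥ (Sᵀ *ᵥ z) := fun z => by
        rw [← Matrix.vecMul_transpose, ← Matrix.dotProduct_mulVec]
      rw [h.inner_eq_dotProduct hx, h.tangComp_tangentVec hx, e, Matrix.mulVec_mulVec,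
        h.shape_transpose_mul_metric hx, Matrix.mulVec_mulVec, mul_assoc, ← pow_two, hsq, mul_zero,
        Matrix.zero_mulVec, dotProduct_zero]
    rw [inner_self_eq_zero] at h1
    have := h.tangComp_tangentVec hx (S *ᵥ v)
    rw [← this, h1, ← tangCompL_apply, map_zero]
  ext i j
  simpa using congrFun (key (Pi.single j 1)) i

end ThinShell

/-! ### Navier-slip and Hodge wall conditions -/

namespace ThinShell

variable {n : ℕ} {V : Set (Coord n)} {φ ν : Coord n → Amb n} {x : Coord n}

namespace IsPatch

/-- The covariant components of an ambient vector in the frame of a parallel surface. -/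
lemma inner_pd_parallel (h : IsPatch V φ ν) (hx : x ∈ V) (r : ℝ) (w : Amb n) (i : Fin n) :
    ⟪w, pd i (parallel φ ν r) x⟫_ℝ
      = (metric φ x *ᵥ ((1 - r • shape φ ν x) *ᵥ tangComp φ x w)) i := by
  have e : metric φ x * (1 - r • shape φ ν x) = (1 - r • shape φ ν x)ᵀ * metric φ x := by
    rw [Matrix.transpose_sub, Matrix.transpose_one, Matrix.transpose_smul, mul_sub, sub_mul,
      mul_one, one_mul, Matrix.smul_mul, Matrix.mul_smul, h.shape_transpose_mul_metric hx]
  rw [h.pd_parallel hx, h.inner_eq_dotProduct hx, Matrix.mulVec_mulVec, e, ← Matrix.mulVec_mulVec,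
    Matrix.mulVec_single_one]
  rfl

lemma inner_pd_normal (h : IsPatch V φ ν) (hx : x ∈ V) (w : Amb n) (i : Fin n) :
    ⟪w, pd i ν x⟫_ℝ = -(metric φ x *ᵥ (shape φ ν x *ᵥ tangComp φ x w)) i := by
  rw [h.pd_normal hx, inner_neg_right, h.inner_eq_dotProduct hx, Matrix.mulVec_mulVec,
    ← h.shape_transpose_mul_metric hx, ← Matrix.mulVec_mulVec, Matrix.mulVec_single_one]
  rfl

/-- The boundary condition in terms of the covariant components in the frame of the parallel
surface. -/
lemma boundaryCond_iff_inner (h : IsPatch V φ ν) (hx : x ∈ V) {U : Amb n → Amb n} {r α : ℝ}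
    (hr : IsUnit (1 - r • shape φ ν x).det) (hU : DifferentiableAt ℝ U (parallel φ ν r x)) :
    BoundaryCond φ ν α U r x ↔ ∀ i,
      ⟪fderiv ℝ U (parallel φ ν r x) (ν x), pd i (parallel φ ν r) x⟫_ℝ
        + (2 * α - 1) * ⟪U (parallel φ ν r x), pd i ν x⟫_ℝ = 0 := by
  have hinj : Function.Injective
      ((metric φ x * (1 - r • shape φ ν x)) *ᵥ · : Coord n → Coord n) :=
    Matrix.mulVec_injective_iff_isUnit.2 ((Matrix.isUnit_iff_isUnit_det _).2
      (by rw [Matrix.det_mul]; exact (h.isUnit_det_metric hx).mul hr))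
  have hcomm : (1 - r • shape φ ν x) * shape φ ν x = shape φ ν x * (1 - r • shape φ ν x) := by
    rw [mul_sub, sub_mul, mul_one, one_mul, Matrix.smul_mul, Matrix.mul_smul]
  rw [h.boundaryCond_iff hx hr hU, ← hinj.eq_iff, funext_iff]
  refine forall_congr' fun i => ?_
  rw [h.inner_pd_parallel hx, h.inner_pd_normal hx, ← h.mulVec_fermiComp hx hr]
  simp only [Matrix.mulVec_smul, Matrix.mulVec_mulVec, mul_assoc, hcomm, Pi.smul_apply, smul_eq_mul,
    mul_neg]
  rw [← sub_eq_add_neg, sub_eq_zero]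

/-- Tangent vectors of a parallel surface are combinations of its coordinate frame. -/
lemma exists_tangentVec_parallel (h : IsPatch V φ ν) (hx : x ∈ V) {r : ℝ}
    (hr : IsUnit (1 - r • shape φ ν x).det) {X : Amb n} (hX : ⟪X, ν x⟫_ℝ = 0) :
    ∃ c, X = tangentVec (parallel φ ν r) x c := by
  refine ⟨(1 - r • shape φ ν x)⁻¹ *ᵥ tangComp φ x X, ?_⟩
  have e : ∀ c, tangentVec (parallel φ ν r) x c = tangentVec φ x ((1 - r • shape φ ν x) *ᵥ c) := by
    intro c
    conv_rhs => rw [pi_eq_sum_univ' c, Matrix.mulVec_sum, ← tangentVecL_apply, map_sum]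
    refine Finset.sum_congr rfl fun i _ => ?_
    rw [Matrix.mulVec_smul, map_smul, h.pd_parallel hx, tangentVecL_apply]
  rw [e, Matrix.mulVec_mulVec, Matrix.mul_nonsing_inv _ hr, Matrix.one_mulVec,
    h.tangentVec_tangComp_of_tangent hx hX]

lemma inner_pd_parallel_normal (h : IsPatch V φ ν) (hx : x ∈ V) (r : ℝ) (i : Fin n) :
    ⟪pd i (parallel φ ν r) x, ν x⟫_ℝ = 0 := by
  rw [h.pd_parallel hx, h.inner_tangentVec_normal hx]

/-- A condition that is linear in the tangent vector need only be tested on the frame. -/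
lemma forall_tangent_iff (h : IsPatch V φ ν) (hx : x ∈ V) {r : ℝ}
    (hr : IsUnit (1 - r • shape φ ν x).det) (L : Amb n →L[ℝ] ℝ) :
    (∀ X : Amb n, ⟪X, ν x⟫_ℝ = 0 → L X = 0) ↔ ∀ i, L (pd i (parallel φ ν r) x) = 0 := by
  refine ⟨fun hL i => hL _ (h.inner_pd_parallel_normal hx r i), fun hL X hX => ?_⟩
  obtain ⟨c, rfl⟩ := h.exists_tangentVec_parallel hx hr hX
  simp [tangentVec, hL]

lemma differentiableAt_parallel (h : IsPatch V φ ν) (hx : x ∈ V) (r : ℝ) :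
    DifferentiableAt ℝ (parallel φ ν r) x :=
  (h.differentiableAt_param hx).add ((h.differentiableAt_normal hx).const_smul r)

/-- For a field tangential to a parallel surface, the tangential derivatives of its normal
component are given by the shape operator. -/
lemma inner_fderiv_pd_parallel (h : IsPatch V φ ν) (hx : x ∈ V) {U : Amb n → Amb n} {r : ℝ}
    (hU : DifferentiableAt ℝ U (parallel φ ν r x))
    (htan : ∀ᶠ y in 𝓝 x, ⟪U (parallel φ ν r y), ν y⟫_ℝ = 0) (i : Fin n) :
    ⟪fderiv ℝ U (parallel φ ν r x) (pd i (parallel φ ν r) x), ν x⟫_ℝ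
      = -⟪U (parallel φ ν r x), pd i ν x⟫_ℝ := by
  have hp := h.differentiableAt_parallel hx r
  have h1 : pd i (fun y => ⟪U (parallel φ ν r y), ν y⟫_ℝ) x = 0 := by
    have : (fun y => ⟪U (parallel φ ν r y), ν y⟫_ℝ) =ᶠ[𝓝 x] fun _ => 0 := htan
    simp [pd, this.fderiv_eq]
  rw [pd_inner (f := fun y => U (parallel φ ν r y)) (hU.comp x hp) (h.differentiableAt_normal hx),
    pd_comp hU hp] at h1
  linarith

/-- Tangency turns `⟨∇̄_X U, N⟩` on the frame into `-⟨U, ∂_i ν⟩`, matching the coefficient `2α - 1 =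
-1`. The vorticity condition carries the opposite sign and so matches `α = 1`. -/
lemma navierSlip_iff (h : IsPatch V φ ν) (hx : x ∈ V) {U : Amb n → Amb n} {r : ℝ}
    (hr : IsUnit (1 - r • shape φ ν x).det) (hU : DifferentiableAt ℝ U (parallel φ ν r x))
    (htan : ∀ᶠ y in 𝓝 x, ⟪U (parallel φ ν r y), ν y⟫_ℝ = 0) :
    BoundaryCond φ ν 0 U r x ↔ NavierSlip U (parallel φ ν r x) (ν x) := by
  let L : Amb n →L[ℝ] ℝ := innerSL ℝ (fderiv ℝ U (parallel φ ν r x) (ν x))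
    + (innerSL ℝ (ν x)).comp (fderiv ℝ U (parallel φ ν r x))
  have e : NavierSlip U (parallel φ ν r x) (ν x) ↔ ∀ X : Amb n, ⟪X, ν x⟫_ℝ = 0 → L X = 0 := by
    simp [NavierSlip, L, real_inner_comm]
  rw [e, h.forall_tangent_iff hx hr, h.boundaryCond_iff_inner hx hr hU]
  refine forall_congr' fun i => ?_
  simp only [L, add_apply, ContinuousLinearMap.comp_apply, innerSL_apply_apply]
  rw [← real_inner_comm (ν x), h.inner_fderiv_pd_parallel hx hU htan]
  norm_num

lemma zeroTangentialVorticity_iff (h : IsPatch V φ ν) (hx : x ∈ V) {U : Amb n → Amb n} {r : ℝ}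
    (hr : IsUnit (1 - r • shape φ ν x).det) (hU : DifferentiableAt ℝ U (parallel φ ν r x))
    (htan : ∀ᶠ y in 𝓝 x, ⟪U (parallel φ ν r y), ν y⟫_ℝ = 0) :
    BoundaryCond φ ν 1 U r x ↔ ZeroTangentialVorticity U (parallel φ ν r x) (ν x) := by
  let L : Amb n →L[ℝ] ℝ := innerSL ℝ (fderiv ℝ U (parallel φ ν r x) (ν x))
    - (innerSL ℝ (ν x)).comp (fderiv ℝ U (parallel φ ν r x))
  have e : ZeroTangentialVorticity U (parallel φ ν r x) (ν x) ↔
      ∀ X : Amb n, ⟪X, ν x⟫_ℝ = 0 → L X = 0 := by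
    simp [ZeroTangentialVorticity, L, real_inner_comm]
  rw [e, h.forall_tangent_iff hx hr, h.boundaryCond_iff_inner hx hr hU]
  refine forall_congr' fun i => ?_
  simp only [L, sub_apply, ContinuousLinearMap.comp_apply, innerSL_apply_apply]
  rw [← real_inner_comm (ν x), h.inner_fderiv_pd_parallel hx hU htan]
  norm_num

/-- At `α = 1` the covariant form of the condition is exactly the product rule for `∂_r U_i`,
because `∂_r` of the frame is `∂_i ν`; tangency of `U` plays no role. -/
lemma deriv_fermiCocomp_iff (h : IsPatch V φ ν) (hx : x ∈ V) {U : Amb n → Amb n} {r : ℝ}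
    (hr : IsUnit (1 - r • shape φ ν x).det) (hU : DifferentiableAt ℝ U (parallel φ ν r x)) :
    BoundaryCond φ ν 1 U r x ↔ ∀ i, deriv (fun s => fermiCocomp φ ν U s x i) r = 0 := by
  rw [h.boundaryCond_iff_inner hx hr hU]
  refine forall_congr' fun i => ?_
  have hpd : ∀ s, pd i (parallel φ ν s) x = pd i φ x + s • pd i ν x := fun s => by
    unfold parallel
    rw [pd_add (h.differentiableAt_param hx) ((h.differentiableAt_normal hx).fun_const_smul s),
      pd_const_smul (h.differentiableAt_normal hx)]
  have h1 : HasDerivAt (fun s : ℝ => parallel φ ν s x) (ν x) r := by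
    simpa [parallel] using ((hasDerivAt_id r).smul_const (ν x)).const_add (φ x)
  have h2 : HasDerivAt (fun s : ℝ => pd i (parallel φ ν s) x) (pd i ν x) r := by
    simp only [hpd]
    simpa using ((hasDerivAt_id r).smul_const (pd i ν x)).const_add (pd i φ x)
  have h3 : HasDerivAt (fun s => fermiCocomp φ ν U s x i)
      (⟪U (parallel φ ν r x), pd i ν x⟫_ℝ
        + ⟪fderiv ℝ U (parallel φ ν r x) (ν x), pd i (parallel φ ν r) x⟫_ℝ) r :=
    (hU.hasFDerivAt.comp_hasDerivAt r h1).inner ℝ h2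
  rw [h3.deriv]
  norm_num [add_comm]

end IsPatch

end ThinShell

/-! ### Assembly of the theorem -/

theorem theorem3 {n : ℕ} (M : Set (ThinShell.Amb n)) (N : ThinShell.Amb n → ThinShell.Amb n)
    (hM : ThinShell.IsOrientedHypersurface M N)
    (V : Set (ThinShell.Coord n)) (φ : ThinShell.Coord n → ThinShell.Amb n)
    (hφ : ThinShell.IsLocalParam M V φ) (x : ThinShell.Coord n) (hx : x ∈ V) :
    -- the effective operator, for every tangent field `u`, with components `u^i` in the chart
    (∀ α ∈ Set.Icc (0 : ℝ) 1, ∀ u, ThinShell.IsTangentField M N u →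
      ThinShell.IsEffectiveValue M N α u (φ x) (ThinShell.tangentVec φ x
        (ThinShell.defLap (ThinShell.metric φ) (fun y => ThinShell.tangComp φ y (u (φ y))) x
          - (2 * α) • (ThinShell.ricciEnd (ThinShell.metric φ) x *ᵥ
              ThinShell.tangComp φ x (u (φ x)))
          - (4 * α * (1 - α)) • ((ThinShell.shape φ (N ∘ φ) x) ^ 2 *ᵥ
              ThinShell.tangComp φ x (u (φ x)))))) ∧
    -- the endpoint `α = 0`
    (∀ u, ThinShell.IsTangentField M N u →
      ThinShell.IsEffectiveValue M N 0 u (φ x) (ThinShell.tangentVec φ x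
        (ThinShell.defLap (ThinShell.metric φ)
          (fun y => ThinShell.tangComp φ y (u (φ y))) x))) ∧
    -- the endpoint `α = 1`
    (∀ u, ThinShell.IsTangentField M N u →
      ThinShell.IsEffectiveValue M N 1 u (φ x) (ThinShell.tangentVec φ x
        (ThinShell.hodgeLap (ThinShell.metric φ)
          (fun y => ThinShell.tangComp φ y (u (φ y))) x))) ∧
    -- where `S ≠ 0`, the term in `S ^ 2` drops out of the operator exactly at the endpoints
    (∀ α ∈ Set.Icc (0 : ℝ) 1,
      ((∀ u, ThinShell.IsTangentField M N u →
        ThinShell.IsEffectiveValue M N α u (φ x) (ThinShell.tangentVec φ x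
          (ThinShell.defLap (ThinShell.metric φ) (fun y => ThinShell.tangComp φ y (u (φ y))) x
            - (2 * α) • (ThinShell.ricciEnd (ThinShell.metric φ) x *ᵥ
                ThinShell.tangComp φ x (u (φ x)))))) ↔
        α = 0 ∨ α = 1 ∨ ThinShell.shape φ (N ∘ φ) x = 0)) ∧
    -- for fields tangential to the parallel surfaces, `α = 0` is the Navier-slip condition and
    -- `α = 1` is the Hodge condition, which says that the `U_i` are constant in `r`
    (∀ (Ω : Set (ThinShell.Amb n)) (U : ThinShell.Amb n → ThinShell.Amb n), IsOpen Ω →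
      φ x ∈ Ω → ContDiffOn ℝ ∞ U Ω → ∀ᶠ r in 𝓝 (0 : ℝ),
        (∀ᶠ y in 𝓝 x, ⟪U (ThinShell.parallel φ (N ∘ φ) r y), N (φ y)⟫_ℝ = 0) →
        (ThinShell.BoundaryCond φ (N ∘ φ) 0 U r x ↔
          ThinShell.NavierSlip U (ThinShell.parallel φ (N ∘ φ) r x) (N (φ x))) ∧
        (ThinShell.BoundaryCond φ (N ∘ φ) 1 U r x ↔
          ThinShell.ZeroTangentialVorticity U (ThinShell.parallel φ (N ∘ φ) r x) (N (φ x))) ∧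
        (ThinShell.BoundaryCond φ (N ∘ φ) 1 U r x ↔
          ∀ i, deriv (fun s => ThinShell.fermiCocomp φ (N ∘ φ) U s x i) r = 0)) := by
  have h := hM.isPatch hφ
  refine ⟨fun α _ u hu => ThinShell.isEffectiveValue hM hφ hx α hu, fun u hu => ?_, fun u hu => ?_, fun α _ => ⟨fun H => ?_,
    fun H u hu => ?_⟩, fun Ω U hΩ hq hU => ?_⟩
  · simpa using ThinShell.isEffectiveValue hM hφ hx 0 hu
  · have hv : ∀ i, ContDiffOn ℝ ∞ (fun y => ThinShell.tangComp φ y (u (φ y)) i) V :=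
      h.contDiffOn_tangComp (hu.smooth V φ hφ)
    have h1 := ThinShell.isEffectiveValue hM hφ hx 1 hu
    -- At `α = 1`, `Δ_B + Ric - 2 Ric = Δ_B - Ric`, the Weitzenböck form of `Δ_H`.
    rw [h.isSmoothMetric.hodgeLap_eq hx hv]
    rw [ThinShell.defLap] at h1
    convert h1 using 2
    module
  · by_contra hcon
    push Not at hcon
    obtain ⟨h0, h1, hS⟩ := hcon
    refine hS (h.shape_eq_zero_of_sq hx ?_)
    have hcoef : 4 * α * (1 - α) ≠ 0 := mul_ne_zero (by simpa using h0) (sub_ne_zero.2 (Ne.symm h1))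
    have key : ∀ v, ThinShell.shape φ (N ∘ φ) x ^ 2 *ᵥ v = 0 := fun v => by
      -- The tangential part of a constant vector gives a global tangent field with prescribed value
      -- `v` at the point; uniqueness of effective values then forces `S² v = 0`.
      set w := ThinShell.tangentVec φ x v with hw
      have hu := ThinShell.isTangentField_tangentialPart hM w
      have heq := (H _ hu).unique (ThinShell.isEffectiveValue hM hφ hx α hu)
      have hval : ThinShell.tangComp φ x (ThinShell.tangentialPart (N (φ x)) w) = v := by
        have : ⟪w, N (φ x)⟫_ℝ = 0 := h.inner_tangentVec_normal hx v
        rw [ThinShell.tangentialPart, this, zero_smul, sub_zero, hw, h.tangComp_tangentVec hx]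
      have heq' := congrArg (ThinShell.tangComp φ x) heq
      rw [h.tangComp_tangentVec hx, h.tangComp_tangentVec hx, hval, eq_comm, sub_eq_self] at heq'
      exact (smul_eq_zero.1 heq').resolve_left hcoef
    ext i j
    simpa using congrFun (key (Pi.single j 1)) i
  · have hzero : (4 * α * (1 - α)) • ((ThinShell.shape φ (N ∘ φ) x) ^ 2 *ᵥ
        ThinShell.tangComp φ x (u (φ x))) = 0 := by
      rcases H with rfl | rfl | hS
      · simp
      · simp
      · simp [hS]
    have h1 := ThinShell.isEffectiveValue hM hφ hx α hu
    rwa [hzero, sub_zero] at h1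
  · have hc : ContinuousAt (fun r : ℝ => ThinShell.parallel φ (N ∘ φ) r x) 0 := by
      unfold ThinShell.parallel; fun_prop
    have hΩr : ∀ᶠ r in 𝓝 (0 : ℝ), ThinShell.parallel φ (N ∘ φ) r x ∈ Ω :=
      hc.eventually_mem (hΩ.mem_nhds (by simpa [ThinShell.parallel] using hq))
    have hunit : ∀ᶠ r in 𝓝 (0 : ℝ), IsUnit (1 - r • ThinShell.shape φ (N ∘ φ) x).det :=
      (ThinShell.IsPatch.isOpen_isUnit_det _).mem_nhds (by simp)
    filter_upwards [hΩr, hunit] with r h1 h2 htan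
    have hd := ThinShell.differentiableAt_of_contDiffOn hΩ hU h1
    exact ⟨h.navierSlip_iff hx h2 hd htan, h.zeroTangentialVorticity_iff hx h2 hd htan,
      h.deriv_fermiCocomp_iff hx h2 hd⟩
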